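/- Let $f:\mathbb R^d\to\mathbb R$ be $C^3$ and bounded below, $f^*=\inf f$, with $\|\nabla f(x)-\nabla f(y)\|\le L\|x-y\|$ for all $x,y$ (some $L>0$) and $\liminf_{\|x\|\to\infty}\|\nabla f(x)\|>0$. Let $\nabla f(x;\xi)$ be a stochastic gradient, jointly measurable in $(x,\xi)$, such that for $\xi\sim\nu$ and every $x\in\mathbb R^d$, $\mathbb E[\nabla f(x;\xi)]=\nabla f(x)$ and (ABC condition) $\mathbb E\|\nabla f(x;\xi)\|^2\le A(f(x)-f^*)+B\|\nabla f(x)\|^2+C$ with constants $A,B,C\ge 0$. Let $(\mathcal F_n)$ be a filtration and $\xi_n$ ($n\ge1$) samples with law $\nu$, $\xi_n$ being $\mathcal F_{n+1}$-measurable and independent of $\mathcal F_n$. Let $\beta\in[0,1)$ and let $\alpha_n>0$ ($n\ge1$) satisfy $\sum\alpha_n=\infty$ and $\sum\alpha_n^2<\infty$. Write $g_n=\nabla f(x_n;\xi_n)$ and consider, for $n\ge1$, either (SHB) $x_{n+1}=x_n-\alpha_n g_n+\beta(x_n-x_{n-1})$, with $\mathcal F_1$-measurable initial conditions $x_0,x_1$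 and $v_n=x_n-x_{n-1}$; or (SNAG) $y_{n+1}=x_n-\alpha_n g_n$, $x_{n+1}=y_{n+1}+\beta(y_{n+1}-y_n)$, with $\mathcal F_1$-measurable initial conditions $y_1,x_1$ and $v_n=x_n-y_n$. In both cases put $z_n=x_n+\frac{\beta}{1-\beta}v_n$. The gradient system $\dot x=-\nabla f(x)$ generates a unique global flow $(\Phi_t)_{t\in\mathbb R}$ on $\mathbb R^d$, and for both SHB and SNAG the following holds almost surely. 1. $(z_n)$ is a bounded perturbed Robbins–Monro sequence with step sizes $a_n=\alpha_n/(1-\beta)$. That is, $a_n>0$, $\sum a_n=\infty$, $a_n\to0$, $(z_n)$ is bounded, and there are sequences $(u_n),(b_n)$ in $\mathbb R^d$ with $z_{n+1}=z_n+a_n(-\nabla f(z_n)+u_n+b_n)$ for $n\ge1$, $b_n\to0$, and, for each $T>0$, $$\lim_{n\to\infty}\ \sup_{k:\,0\le\tau_k-\tau_n\le T}\Big\|\sum_{i=n}^{k-1}a_iu_i\Big\|=0,\qquad \tau_n=\sum_{i=1}^n a_i.$$ 2. The limit set (the set of subsequential limits) of $(z_n)$ equals that of $(x_n)$. It is nonempty,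 compact, connected, invariant under the flow ($\Phi_t$ maps it onto itself for every $t\in\mathbb R$), and contained in the chain recurrent set of $\Phi$. Here $p$ is chain recurrent if for all $\delta,T>0$ there are $k\ge1$, points $y_0,\dots,y_k=p$ and times $t_0,\dots,t_{k-1}\ge T$ with $\|y_0-p\|<\delta$ and $\|\Phi_{t_i}(y_i)-y_{i+1}\|<\delta$ for all $i<k$. -/

import Mathlib

open Filter Topology MeasureTheory ProbabilityTheory

namespace MomentumSGD

/-- `L`-smoothness: `f` has a `C²` gradient (so `f` is `C³`), and the gradient is `L`-Lipschitz. -/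
structure IsLSmooth {d : ℕ} (f : EuclideanSpace ℝ (Fin d) → ℝ) (L : ℝ) : Prop where
  pos : 0 < L
  contDiff : ContDiff ℝ 3 f
  lipschitz : ∀ x y, ‖gradient f x - gradient f y‖ ≤ L * ‖x - y‖

/-- Asymptotic non-flatness: `liminf_{‖x‖ → ∞} ‖∇f(x)‖ > 0`, the lower limit being taken in
`[0, ∞]`. -/
def AsymptoticallyNonFlat {d : ℕ} (f : EuclideanSpace ℝ (Fin d) → ℝ) : Prop :=
  0 < liminf (fun x => ‖gradient f x‖ₑ) (Bornology.cobounded (EuclideanSpace ℝ (Fin d)))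

/-- `G x s` is an unbiased stochastic gradient of `f` at `x` when the sample `s` has law `ν`. -/
structure IsUnbiasedOracle {d : ℕ} {Ξ : Type*} [MeasurableSpace Ξ]
    (f : EuclideanSpace ℝ (Fin d) → ℝ)
    (G : EuclideanSpace ℝ (Fin d) → Ξ → EuclideanSpace ℝ (Fin d)) (ν : Measure Ξ) : Prop where
  measurable : Measurable (Function.uncurry G)
  integrable : ∀ x, Integrable (G x) ν
  unbiased : ∀ x, ∫ s, G x s ∂ν = gradient f x

/-- The ABC condition, for `f` bounded below with `f^* = inf f`. -/
structure ABCCondition {d : ℕ} {Ξ : Type*} [MeasurableSpace Ξ]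
    (f : EuclideanSpace ℝ (Fin d) → ℝ)
    (G : EuclideanSpace ℝ (Fin d) → Ξ → EuclideanSpace ℝ (Fin d)) (ν : Measure Ξ) : Prop where
  bddBelow : BddBelow (Set.range f)
  integrable_sq : ∀ x, Integrable (fun s => ‖G x s‖ ^ 2) ν
  bound : ∃ A B C : ℝ, 0 ≤ A ∧ 0 ≤ B ∧ 0 ≤ C ∧
    ∀ x, ∫ s, ‖G x s‖ ^ 2 ∂ν ≤ A * (f x - ⨅ w, f w) + B * ‖gradient f x‖ ^ 2 + C

/-- The samples `ξ₁, ξ₂, …`: each has law `ν`, `ξₙ` is known at time `n + 1`, and it is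
independent of the past `ℱₙ`. -/
structure IsSampling {Ω Ξ : Type*} {mΩ : MeasurableSpace Ω} [MeasurableSpace Ξ]
    (P : Measure Ω) (ℱ : Filtration ℕ mΩ) (ν : Measure Ξ) (ξ : ℕ → Ω → Ξ) : Prop where
  adapted : ∀ n, 1 ≤ n → Measurable[ℱ (n + 1)] (ξ n)
  indep : ∀ n, 1 ≤ n → Indep (MeasurableSpace.comap (ξ n) inferInstance) (ℱ n) P
  law : ∀ n, 1 ≤ n → P.map (ξ n) = ν

/-- Step sizes `α₁, α₂, …`: positive, `∑ αₙ = ∞` and `∑ αₙ² < ∞`. -/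
structure StepSizes (α : ℕ → ℝ) : Prop where
  pos : ∀ n, 1 ≤ n → 0 < α n
  sum_eq_top : Tendsto (fun n => ∑ i ∈ Finset.Icc 1 n, α i) atTop atTop
  sum_sq : Summable (fun n => α n ^ 2)

section Iterations

variable {E : Type*} [AddCommGroup E] [Module ℝ E]

/-- One trajectory of the stochastic heavy-ball method, started from `x₀, x₁`;
`g n` is the stochastic gradient used at `x n`. -/
def IsSHB (α : ℕ → ℝ) (β : ℝ) (g x : ℕ → E) : Prop :=
  ∀ n, 1 ≤ n → x (n + 1) = x n - α n • g n + β • (x n - x (n - 1))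

/-- The auxiliary sequence of SHB, `zₙ = xₙ + β / (1 - β) vₙ` with `vₙ = xₙ - xₙ₋₁` (`n ≥ 1`). -/
noncomputable def auxSHB (β : ℝ) (x : ℕ → E) (n : ℕ) : E :=
  x n + (β / (1 - β)) • (x n - x (n - 1))

/-- One trajectory of the stochastic Nesterov method, started from `y₁, x₁`;
`g n` is the stochastic gradient used at `x n`. -/
def IsSNAG (α : ℕ → ℝ) (β : ℝ) (g x y : ℕ → E) : Prop :=
  ∀ n, 1 ≤ n →
    y (n + 1) = x n - α n • g n ∧ x (n + 1) = y (n + 1) + β • (y (n + 1) - y n)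

/-- The auxiliary sequence of SNAG, `zₙ = xₙ + β / (1 - β) vₙ` with `vₙ = xₙ - yₙ` (`n ≥ 1`).
This `v` satisfies `vₙ₊₁ = β vₙ - β αₙ gₙ`, and `zₙ₊₁ = zₙ - αₙ / (1 - β) gₙ`. -/
noncomputable def auxSNAG (β : ℝ) (x y : ℕ → E) (n : ℕ) : E :=
  x n + (β / (1 - β)) • (x n - y n)

end Iterations

/-- `z₁, z₂, …` is a bounded perturbed Robbins–Monro sequence for `-∇f` with step sizes `aₙ`:
`zₙ₊₁ = zₙ + aₙ (-∇f(zₙ) + uₙ + bₙ)`, where `aₙ > 0`, `∑ aₙ = ∞`, `aₙ → 0`, `z` is bounded,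
`bₙ → 0`, and for each `T > 0`, with `τₙ = a₁ + ⋯ + aₙ`,
`sup {‖∑_{i=n}^{k-1} aᵢ uᵢ‖ : 0 ≤ τₖ - τₙ ≤ T} → 0` as `n → ∞`. -/
def IsBoundedPerturbedRM {d : ℕ} (f : EuclideanSpace ℝ (Fin d) → ℝ) (a : ℕ → ℝ)
    (z : ℕ → EuclideanSpace ℝ (Fin d)) : Prop :=
  (∀ n, 1 ≤ n → 0 < a n) ∧
  Tendsto (fun n => ∑ i ∈ Finset.Icc 1 n, a i) atTop atTop ∧
  Tendsto a atTop (𝓝 0) ∧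
  Bornology.IsBounded (Set.range z) ∧
  ∃ u b : ℕ → EuclideanSpace ℝ (Fin d),
    (∀ n, 1 ≤ n → z (n + 1) = z n + a n • (-gradient f (z n) + u n + b n)) ∧
    Tendsto b atTop (𝓝 0) ∧
    ∀ T : ℝ, 0 < T → ∀ ε : ℝ, 0 < ε → ∃ N : ℕ, ∀ n k : ℕ, N ≤ n → 1 ≤ n →
      0 ≤ (∑ i ∈ Finset.Icc 1 k, a i) - (∑ i ∈ Finset.Icc 1 n, a i) →
      (∑ i ∈ Finset.Icc 1 k, a i) - (∑ i ∈ Finset.Icc 1 n, a i) ≤ T →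
      ‖∑ i ∈ Finset.Ico n k, a i • u i‖ ≤ ε

/-- `Φ` is the flow of the gradient system `ẋ = -∇f(x)`. -/
def IsGradientFlow {d : ℕ} (f : EuclideanSpace ℝ (Fin d) → ℝ)
    (Φ : Flow ℝ (EuclideanSpace ℝ (Fin d))) : Prop :=
  ∀ x t, HasDerivAt (fun s => Φ s x) (-gradient f (Φ t x)) t

/-- The limit set of a sequence: the set of its subsequential limits. -/
def limitSet {X : Type*} [TopologicalSpace X] (z : ℕ → X) : Set X :=
  {p | MapClusterPt p atTop z}

/-- The chain recurrent set of a flow: the points `p` such that for all `δ > 0` and `T > 0` there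
is a `(δ, T)`-pseudo-orbit from `p` to `p`, that is, points `y₀, …, yₖ = p` (`k ≥ 1`) and times
`t₀, …, tₖ₋₁ ≥ T` with `d(y₀, p) < δ` and `d(Φ_{tᵢ}(yᵢ), yᵢ₊₁) < δ` for `i < k`. -/
def chainRecurrentSet {X : Type*} [PseudoMetricSpace X] (Φ : Flow ℝ X) : Set X :=
  {p | ∀ δ : ℝ, 0 < δ → ∀ T : ℝ, 0 < T →
    ∃ (k : ℕ) (y : ℕ → X) (t : ℕ → ℝ), 1 ≤ k ∧ (∀ i < k, T ≤ t i) ∧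
      dist (y 0) p < δ ∧ (∀ i < k, dist (Φ (t i) (y i)) (y (i + 1)) < δ) ∧ y k = p}

/-- The set `S` is nonempty, compact, connected, invariant under every time-`t` map of `Φ`
(`t ∈ ℝ`), and contained in the chain recurrent set of `Φ`. -/
def IsChainRecurrentContinuum {X : Type*} [PseudoMetricSpace X] (Φ : Flow ℝ X)
    (S : Set X) : Prop :=
  S.Nonempty ∧ IsCompact S ∧ IsConnected S ∧ (∀ t : ℝ, Φ t '' S = S) ∧ S ⊆ chainRecurrentSet Φ

end MomentumSGD

/-!
Both momentum methods have the same structure in the variables `zₙ` and `vₙ`: the auxiliary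
sequence makes plain stochastic gradient steps `zₙ₊₁ = zₙ - aₙ gₙ` with `aₙ = αₙ / (1 - β)`, the
velocity is contracted, `vₙ₊₁ = β vₙ - κ aₙ gₙ`, and the gradient is evaluated at
`xₙ = zₙ - c vₙ` with `c = β / (1 - β)` (`IsMomentumScheme`). All arguments are made for this
common form.

*Stability.* The energy `f(z) - inf f + ‖v‖² + 1` grows in conditional expectation by a factor of
at most `1 + K aₙ²` (`exists_lintegral_energy_le`): the decrease `-aₙ ‖∇f(xₙ)‖²` and the contraction
of the velocity absorb all terms of first order in `aₙ`. Normalised by `∏ (1 + K aᵢ²)`, it is a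
nonnegative supermartingale, so by the maximal inequality it is almost surely bounded
(`ae_bounded_of_almost_supermartingale`). The maximal inequality is proved for the integrals over
past events, in `[0, ∞]`, hence no integrability of the initial conditions is needed. Sublevel
sets of `f` are bounded because the gradient does not flatten at infinity
(`IsLSmooth.isBounded_sublevel`), so `zₙ`, `vₙ` and `xₙ` are almost surely bounded.

*Noise.* With `uₙ = ∇f(xₙ) - gₙ`, truncated to bounded iterates, the sums `∑ aₙ uₙ` form a
martingale with square-summable increments; the same maximal inequality makes them converge almost
surely (`ae_cauchySeq_noise`). Consequently `aₙ gₙ → 0`, so `vₙ → 0` and `xₙ - zₙ → 0`. Thus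
`bₙ = ∇f(zₙ) - ∇f(xₙ) → 0` and `zₙ` is a perturbed Robbins–Monro sequence with the same
limit set as `xₙ`.

*Dynamics.* The gradient field is Lipschitz and so generates a unique global flow. By a discrete
Grönwall argument, a bounded perturbed Robbins–Monro sequence shadows the flow over time windows of
bounded length (`IsBoundedPerturbedRM.isAsymptoticPseudotrajectory`). Shadowing makes the limit set
invariant and connected; cutting a stretch of the sequence between two visits near a limit point
into pieces of bounded length gives pseudo-orbits, which makes every limit point chain recurrent
(`IsAsymptoticPseudotrajectory.isChainRecurrentContinuum`).
-/

namespace MomentumSGD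

/-! ### The flow of a Lipschitz vector field -/

section LipschitzFlow

open scoped NNReal Manifold

variable {E : Type*} [NormedAddCommGroup E] [NormedSpace ℝ E] {F : E → E} {K : ℝ≥0}

theorem dist_integralCurve_le (hF : LipschitzWith K F) {γ η : ℝ → E}
    (hγ : ∀ t, HasDerivAt γ (F (γ t)) t) (hη : ∀ t, HasDerivAt η (F (η t)) t) (t : ℝ) :
    dist (γ t) (η t) ≤ dist (γ 0) (η 0) * Real.exp (K * |t|) := by
  have key : ∀ {F : E → E} {γ η : ℝ → E}, LipschitzWith K F →
      (∀ t, HasDerivAt γ (F (γ t)) t) → (∀ t, HasDerivAt η (F (η t)) t) → ∀ t, 0 ≤ t →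
      dist (γ t) (η t) ≤ dist (γ 0) (η 0) * Real.exp (K * t) := by
    intro F γ η hF hγ hη t ht
    simpa using dist_le_of_trajectories_ODE (a := 0) (b := t) (v := fun _ => F) (fun _ => hF)
      (fun r _ => (hγ r).continuousAt.continuousWithinAt) (fun r _ => (hγ r).hasDerivWithinAt)
      (fun r _ => (hη r).continuousAt.continuousWithinAt) (fun r _ => (hη r).hasDerivWithinAt)
      le_rfl t ⟨ht, le_rfl⟩
  rcases le_total 0 t with ht | ht
  · rw [abs_of_nonneg ht]
    exact key hF hγ hη t ht
  · have hrev : ∀ {γ : ℝ → E}, (∀ t, HasDerivAt γ (F (γ t)) t) →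
        ∀ t, HasDerivAt (fun r => γ (-r)) (-F (γ (-t))) t := fun hγ t => by
      simpa [Function.comp_def] using (hγ (-t)).scomp t (hasDerivAt_neg t)
    simpa [abs_of_nonpos ht] using key (F := fun x => -F x) hF.neg (hrev hγ) (hrev hη) (-t)
      (neg_nonneg.2 ht)

theorem integralCurve_unique (hF : LipschitzWith K F) {γ η : ℝ → E}
    (hγ : ∀ t, HasDerivAt γ (F (γ t)) t) (hη : ∀ t, HasDerivAt η (F (η t)) t)
    (h : γ 0 = η 0) : γ = η := by
  ext t
  simpa [h] using dist_integralCurve_le hF hγ hη t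

/-- A `C¹` globally Lipschitz vector field is complete: the Picard–Lindelöf time of existence
`1 / (2 (K + 1))` does not depend on the starting point. -/
theorem exists_integralCurve [CompleteSpace E] (hF : LipschitzWith K F) (hF1 : ContDiff ℝ 1 F)
    (x : E) : ∃ γ : ℝ → E, γ 0 = x ∧ ∀ t, HasDerivAt γ (F (γ t)) t := by
  set h : ℝ := 1 / (2 * (K + 1)) with hh
  have hK : (0 : ℝ) < K + 1 := by positivity
  have hpos : 0 < h := by positivity
  have hloc : ∀ x : E, ∃ γ : ℝ → E, γ 0 = x ∧
      IsMIntegralCurveOn (I := 𝓘(ℝ, E)) γ F (Set.Ioo (-h) h) := by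
    intro x
    have hpl : IsPicardLindelof (fun _ : ℝ => F) (tmin := -h) (tmax := h)
        ⟨0, by constructor <;> linarith⟩ x ‖F x‖₊ 0 ((2 * K + 1) * ‖F x‖₊) K := by
      refine ⟨fun _ _ => hF.lipschitzOnWith, fun _ _ => continuousOn_const,
        fun _ _ y hy => ?_, ?_⟩
      · have h1 := hF.dist_le_mul y x
        rw [dist_eq_norm] at h1
        have h2 : (K : ℝ) * dist y x ≤ K * ‖F x‖ :=
          mul_le_mul_of_nonneg_left (Metric.mem_closedBall.1 hy) K.2
        have h3 := norm_sub_norm_le (F y) (F x)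
        push_cast
        nlinarith [norm_nonneg (F x), mul_nonneg K.2 (norm_nonneg (F x))]
      · have : (2 * (K : ℝ) + 1) * h ≤ 1 := by
          rw [hh, mul_one_div, div_le_one (by positivity)]
          linarith
        simp only [sub_zero, zero_sub, neg_neg, max_self, NNReal.coe_zero]
        push_cast
        nlinarith [norm_nonneg (F x)]
    obtain ⟨γ, h0, hγ⟩ := hpl.exists_eq_forall_mem_Icc_hasDerivWithinAt₀
    exact ⟨γ, h0, fun t ht =>
      ((hγ t (Set.Ioo_subset_Icc_self ht)).mono Set.Ioo_subset_Icc_self).hasFDerivWithinAt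
        |>.hasMFDerivWithinAt⟩
  obtain ⟨γ, h0, hγ⟩ := exists_isMIntegralCurve_of_isMIntegralCurveOn (I := 𝓘(ℝ, E)) (v := F)
    (contMDiff_vectorSpace_iff_contDiff.2 hF1) hpos hloc x
  exact ⟨γ, h0, fun t => by
    have h1 : HasFDerivAt γ (ContinuousLinearMap.toSpanSingleton ℝ (F (γ t))) t :=
      (hγ t).hasFDerivAt
    simpa using h1.hasDerivAt⟩

/-- A `C¹` globally Lipschitz vector field generates a unique global flow. -/
theorem existsUnique_flow [CompleteSpace E] (hF : LipschitzWith K F) (hF1 : ContDiff ℝ 1 F) :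
    ∃! Φ : Flow ℝ E, ∀ x t, HasDerivAt (fun s => Φ s x) (F (Φ t x)) t := by
  choose γ h0 hγ using exists_integralCurve hF hF1
  have hcont : Continuous (Function.uncurry fun t x => γ x t) := by
    refine continuous_iff_continuousAt.2 fun ⟨t₀, x₀⟩ => tendsto_iff_dist_tendsto_zero.2 ?_
    have hlim : Tendsto (fun p : ℝ × E => dist p.2 x₀ * Real.exp (K * |p.1|) +
        dist (γ x₀ p.1) (γ x₀ t₀)) (𝓝 (t₀, x₀)) (𝓝 0) := by
      have hc : Continuous (γ x₀) := continuous_iff_continuousAt.2 fun t => (hγ x₀ t).continuousAt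
      have : Continuous fun p : ℝ × E => dist p.2 x₀ * Real.exp (K * |p.1|) +
          dist (γ x₀ p.1) (γ x₀ t₀) := by fun_prop
      simpa using this.tendsto (t₀, x₀)
    refine squeeze_zero (fun _ => dist_nonneg) (fun p => ?_) hlim
    refine (dist_triangle _ (γ x₀ p.1) _).trans (add_le_add_left ?_ _)
    simpa [h0, Function.uncurry_def] using dist_integralCurve_le hF (hγ p.2) (hγ x₀) p.1
  refine ⟨⟨fun t x => γ x t, hcont, fun t₁ t₂ x => ?_, h0⟩, hγ, fun Ψ hΨ => ?_⟩
  · have hshift : ∀ t, HasDerivAt (fun r => γ x (r + t₂)) (F (γ x (t + t₂))) t := fun t =>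
      (hγ x (t + t₂)).comp_add_const t t₂
    exact congrFun (integralCurve_unique hF hshift (hγ (γ x t₂)) (by simp [h0])) t₁
  · ext t x
    exact congrFun (integralCurve_unique hF (hΨ x) (hγ x) (by simp [h0])) t

end LipschitzFlow

/-! ### Smooth functions with non-flat gradient at infinity -/

section Smooth

variable {d : ℕ} {f : EuclideanSpace ℝ (Fin d) → ℝ} {L : ℝ}

namespace IsLSmooth

theorem contDiff_gradient (h : IsLSmooth f L) : ContDiff ℝ 2 (gradient f) :=
  ((InnerProductSpace.toDual ℝ _).symm.contDiff).comp (h.contDiff.fderiv_right (by norm_num))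

theorem continuous_gradient (h : IsLSmooth f L) : Continuous (gradient f) :=
  h.contDiff_gradient.continuous

theorem lipschitzWith_neg_gradient (h : IsLSmooth f L) :
    LipschitzWith L.toNNReal fun x => -gradient f x :=
  LipschitzWith.neg (LipschitzWith.of_dist_le_mul fun x y => by
    rw [dist_eq_norm, dist_eq_norm, Real.coe_toNNReal _ h.pos.le]
    exact h.lipschitz x y)

theorem existsUnique_gradientFlow (h : IsLSmooth f L) :
    ∃! Φ : Flow ℝ (EuclideanSpace ℝ (Fin d)), IsGradientFlow f Φ :=
  existsUnique_flow h.lipschitzWith_neg_gradient (h.contDiff_gradient.neg.of_le (by norm_num))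

theorem hasFDerivAt (h : IsLSmooth f L) (x : EuclideanSpace ℝ (Fin d)) :
    HasFDerivAt f (innerSL ℝ (gradient f x)) x := by
  have := ((h.contDiff.differentiable (by norm_num)) x).hasGradientAt.hasFDerivAt
  exact this

/-- The quadratic upper bound of an `L`-smooth function, with `L` in place of the optimal
`L / 2`. -/
theorem le_quadratic (h : IsLSmooth f L) (x w : EuclideanSpace ℝ (Fin d)) :
    f (x + w) ≤ f x + inner ℝ (gradient f x) w + L * ‖w‖ ^ 2 := by
  have hbd : ∀ y ∈ Metric.closedBall x ‖w‖,
      ‖innerSL ℝ (gradient f y) - innerSL ℝ (gradient f x)‖ ≤ L * ‖w‖ := fun y hy => by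
    rw [← map_sub, innerSL_apply_norm]
    exact (h.lipschitz y x).trans
      (mul_le_mul_of_nonneg_left (mem_closedBall_iff_norm.1 hy) h.pos.le)
  have hmv := (convex_closedBall x ‖w‖).norm_image_sub_le_of_norm_hasFDerivWithin_le'
    (fun y _ => (h.hasFDerivAt y).hasFDerivWithinAt) hbd
    (Metric.mem_closedBall_self (norm_nonneg w)) (y := x + w) (by simp)
  rw [add_sub_cancel_left, innerSL_apply_apply, Real.norm_eq_abs] at hmv
  nlinarith [(abs_le.1 hmv).2]

theorem sq_norm_gradient_le (h : IsLSmooth f L) (hf : BddBelow (Set.range f))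
    (x : EuclideanSpace ℝ (Fin d)) : ‖gradient f x‖ ^ 2 ≤ 4 * L * (f x - ⨅ w, f w) := by
  have hL := h.pos
  -- one gradient step of length `1 / (2 L)`
  have h1 := (ciInf_le hf _).trans (h.le_quadratic x (-(1 / (2 * L)) • gradient f x))
  rw [inner_smul_right, real_inner_self_eq_norm_sq, norm_smul, mul_pow, Real.norm_eq_abs,
    sq_abs] at h1
  have h2 : L * ((-(1 / (2 * L))) ^ 2 * ‖gradient f x‖ ^ 2) + -(1 / (2 * L)) * ‖gradient f x‖ ^ 2
      = -(‖gradient f x‖ ^ 2 / (4 * L)) := by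
    field_simp
    ring
  have h3 : ‖gradient f x‖ ^ 2 / (4 * L) ≤ f x - ⨅ w, f w := by linarith
  rw [div_le_iff₀ (by positivity)] at h3
  linarith

/-- Sublevel sets are bounded. Given `x` far from the origin, the function `y ↦ f y + η ‖y - x‖`
has a minimiser, which is still far from the origin and at which the gradient has norm at most
`η`. -/
theorem isBounded_sublevel (h : IsLSmooth f L) (hf : BddBelow (Set.range f))
    (hflat : AsymptoticallyNonFlat f) (M : ℝ) : Bornology.IsBounded {x | f x ≤ M} := by
  obtain ⟨η, hη, R, hR⟩ : ∃ η : ℝ, 0 < η ∧ ∃ R : ℝ, ∀ x, R < ‖x‖ → η < ‖gradient f x‖ := by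
    obtain ⟨η, hη, hlt⟩ := ENNReal.lt_iff_exists_nnreal_btwn.1 hflat
    refine ⟨η, by exact_mod_cast hη, ?_⟩
    have hev := eventually_lt_of_lt_liminf hlt
    rw [← comap_norm_atTop] at hev
    obtain ⟨s, hs, hsub⟩ := hev
    obtain ⟨R, hR⟩ := mem_atTop_sets.1 hs
    refine ⟨R, fun x hx => ?_⟩
    have := hsub (show ‖x‖ ∈ s from hR _ hx.le)
    rw [Set.mem_ofPred_eq, ← ofReal_norm, ← ENNReal.ofReal_coe_nnreal] at this
    exact (ENNReal.ofReal_lt_ofReal_iff_of_nonneg η.2).1 this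
  refine isBounded_iff_forall_norm_le.2 ⟨R + (M - ⨅ w, f w) / η, fun x hx => ?_⟩
  by_contra! hxn
  have hcont : Continuous fun y => f y + η * ‖y - x‖ := by
    have := h.contDiff.continuous
    fun_prop
  have hcoer : Tendsto (fun y => f y + η * ‖y - x‖)
      (cocompact (EuclideanSpace ℝ (Fin d))) atTop := by
    refine tendsto_atTop_mono (fun y => add_le_add (ciInf_le hf y)
      (mul_le_mul_of_nonneg_left (norm_sub_norm_le y x) hη.le)) ?_
    refine tendsto_atTop_add_const_left _ _ (Tendsto.const_mul_atTop hη ?_)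
    exact tendsto_atTop_add_const_right _ _ tendsto_norm_cocompact_atTop
  obtain ⟨y, hy⟩ := hcont.exists_forall_le hcoer
  have hyx : ‖y - x‖ ≤ (M - ⨅ w, f w) / η := by
    rw [le_div_iff₀ hη]
    have h1 := hy x
    rw [sub_self, norm_zero, mul_zero, add_zero] at h1
    have := ciInf_le hf y
    have hx' : f x ≤ M := hx
    linarith
  have hyR : R < ‖y‖ := by linarith [norm_sub_norm_le x y, norm_sub_rev x y]
  refine absurd (hR y hyR) (not_lt.2 ?_)
  -- compare `y` with `y - r ∇f(y)` for small `r > 0`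
  set p := gradient f y
  have hr : ∀ r : ℝ, 0 < r → ‖p‖ ^ 2 ≤ η * ‖p‖ + r * (L * ‖p‖ ^ 2) := by
    intro r hr
    have h1 := h.le_quadratic y (-r • p)
    have h2 := hy (y + -r • p)
    have h3 : ‖y + -r • p - x‖ ≤ ‖y - x‖ + r * ‖p‖ := by
      calc ‖y + -r • p - x‖ = ‖(y - x) + -r • p‖ := by congr 1; abel
        _ ≤ ‖y - x‖ + ‖-r • p‖ := norm_add_le _ _
        _ = ‖y - x‖ + r * ‖p‖ := by rw [norm_smul, norm_neg, Real.norm_of_nonneg hr.le]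
    rw [inner_smul_right, real_inner_self_eq_norm_sq, norm_smul, norm_neg,
      Real.norm_of_nonneg hr.le] at h1
    have h4 : r * ‖p‖ ^ 2 ≤ r * (η * ‖p‖ + r * (L * ‖p‖ ^ 2)) := by
      nlinarith [mul_le_mul_of_nonneg_left h3 hη.le]
    exact le_of_mul_le_mul_left h4 hr
  have hlim : ‖p‖ ^ 2 ≤ η * ‖p‖ := by
    have ht : Tendsto (fun r : ℝ => η * ‖p‖ + r * (L * ‖p‖ ^ 2)) (𝓝[>] 0) (𝓝 (η * ‖p‖)) := by
      have : Continuous fun r : ℝ => η * ‖p‖ + r * (L * ‖p‖ ^ 2) := by fun_prop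
      simpa using (this.tendsto 0).mono_left nhdsWithin_le_nhds
    exact ge_of_tendsto ht (eventually_mem_nhdsWithin.mono fun r hr' => hr r hr')
  nlinarith [norm_nonneg p]

end IsLSmooth

end Smooth

/-! ### Limit sets of asymptotic pseudotrajectories -/

/-- The sequence `z`, sampled at the times `s`, is an asymptotic pseudotrajectory of the flow `Φ`:
the times increase to infinity with vanishing increments, and over time windows of any fixed
length `T`, `z` is eventually arbitrarily close to the orbit of `Φ` started at the beginning of
the window. -/
structure IsAsymptoticPseudotrajectory {X : Type*} [PseudoMetricSpace X] (Φ : Flow ℝ X)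
    (s : ℕ → ℝ) (z : ℕ → X) : Prop where
  mono : Monotone s
  tendsto_time : Tendsto s atTop atTop
  tendsto_step : Tendsto (fun n => s (n + 1) - s n) atTop (𝓝 0)
  shadow : ∀ T ε : ℝ, 0 < ε → ∃ N, ∀ n k, N ≤ n → n ≤ k → s k - s n ≤ T →
    dist (z k) (Φ (s k - s n) (z n)) < ε

/-- A sequence of times increasing to infinity with vanishing increments comes asymptotically
close to every large real number `r`, at the index `J r`. -/
theorem exists_index_near {s : ℕ → ℝ} (hmono : Monotone s) (htop : Tendsto s atTop atTop)
    (hstep : Tendsto (fun n => s (n + 1) - s n) atTop (𝓝 0)) :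
    ∃ J : ℝ → ℕ, Tendsto J atTop atTop ∧ Tendsto (fun r => s (J r) - r) atTop (𝓝 0) := by
  classical
  have hex : ∀ r, ∃ n, r < s (n + 1) := fun r =>
    ((tendsto_add_atTop_iff_nat 1).2 htop |>.eventually_gt_atTop r).exists
  let J : ℝ → ℕ := fun r => Nat.find (hex r)
  have hlt : ∀ r, r < s (J r + 1) := fun r => Nat.find_spec (hex r)
  have hJ : Tendsto J atTop atTop := by
    refine tendsto_atTop.2 fun M => ?_
    filter_upwards [eventually_ge_atTop (s M)] with r hr
    by_contra! h
    exact absurd (hlt r) (not_lt.2 ((hmono h).trans hr))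
  refine ⟨J, hJ, ?_⟩
  have hb := (hstep.comp hJ).neg
  rw [neg_zero] at hb
  refine tendsto_of_tendsto_of_tendsto_of_le_of_le' hb tendsto_const_nhds ?_ ?_
  · refine Eventually.of_forall fun r => ?_
    have := hlt r
    simp only [Function.comp]
    linarith
  · filter_upwards [hJ.eventually_ge_atTop 1] with r hr
    have h := Nat.find_min (hex r) (m := J r - 1) (Nat.sub_lt hr one_pos)
    rw [Nat.sub_add_cancel hr] at h
    linarith

section LimitSet

variable {X : Type*} [PseudoMetricSpace X]

theorem isClosed_limitSet (z : ℕ → X) : IsClosed (limitSet z) :=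
  isClosed_setOfPred_clusterPt

/-- Along an ultrafilter `U` at infinity, the limit of `z ∘ m` belongs to the limit set of `z`
as soon as the indices `m` tend to infinity. -/
theorem mem_limitSet_of_tendsto {z : ℕ → X} {U : Ultrafilter ℕ} {m : ℕ → ℕ} {q : X}
    (hm : Tendsto m U atTop) (hz : Tendsto (fun n => z (m n)) U (𝓝 q)) : q ∈ limitSet z :=
  (Tendsto.mapClusterPt (u := z ∘ m) hz).of_comp hm

theorem exists_tendsto_of_mem_isCompact {K : Set X} (hK : IsCompact K) {z : ℕ → X}
    (hz : ∀ n, z n ∈ K) (U : Ultrafilter ℕ) (m : ℕ → ℕ) :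
    ∃ q, Tendsto (fun n => z (m n)) U (𝓝 q) := by
  obtain ⟨q, -, hq⟩ := hK.ultrafilter_le_nhds (U.map fun n => z (m n))
    (le_principal_iff.2 (mem_map.2 (univ_mem' fun n => hz (m n))))
  exact ⟨q, hq⟩

namespace IsAsymptoticPseudotrajectory

variable {Φ : Flow ℝ X} {s : ℕ → ℝ} {z : ℕ → X}

/-- If `z` converges to `q` along `m`, then `z` along the later indices `k` stays close to the
orbit of `q`. -/
theorem tendsto_of_tendsto (h : IsAsymptoticPseudotrajectory Φ s z) {U : Filter ℕ} {m k : ℕ → ℕ}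
    {q : X} {t : ℝ} (hm : Tendsto m U atTop) (hz : Tendsto (fun n => z (m n)) U (𝓝 q))
    (hmk : ∀ᶠ n in U, m n ≤ k n) (ht : Tendsto (fun n => s (k n) - s (m n)) U (𝓝 t)) :
    Tendsto (fun n => z (k n)) U (𝓝 (Φ t q)) := by
  have h1 : Tendsto (fun n => Φ (s (k n) - s (m n)) (z (m n))) U (𝓝 (Φ t q)) :=
    (Φ.cont'.tendsto (t, q)).comp (ht.prodMk_nhds hz)
  refine tendsto_iff_dist_tendsto_zero.2 ?_
  refine squeeze_zero (fun _ => dist_nonneg) (fun n => dist_triangle _ _ _)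
    (g := fun n => dist (z (k n)) (Φ (s (k n) - s (m n)) (z (m n))) +
      dist (Φ (s (k n) - s (m n)) (z (m n))) (Φ t q)) ?_
  rw [← add_zero (0 : ℝ)]
  refine Tendsto.add ?_ (tendsto_iff_dist_tendsto_zero.1 h1)
  refine Metric.tendsto_nhds.2 fun ε hε => ?_
  obtain ⟨N, hN⟩ := h.shadow (t + 1) ε hε
  filter_upwards [hm.eventually_ge_atTop N, hmk, ht.eventually_le_const (lt_add_one t)]
    with n h1 h2 h3
  simpa using hN _ _ h1 h2 h3

/-- The limit set is forward and backward invariant. -/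
theorem flow_mem_limitSet (h : IsAsymptoticPseudotrajectory Φ s z) {K : Set X} (hK : IsCompact K)
    (hzK : ∀ n, z n ∈ K) [T2Space X] {p : X} (hp : p ∈ limitSet z) (t : ℝ) :
    Φ t p ∈ limitSet z := by
  obtain ⟨U, hU, hzp⟩ := mapClusterPt_iff_ultrafilter.1 hp
  obtain ⟨J, hJ, hJs⟩ := exists_index_near h.mono h.tendsto_time h.tendsto_step
  have hr : Tendsto (fun n => s n + t) U atTop :=
    tendsto_atTop_add_const_right _ _ (h.tendsto_time.mono_left hU)
  let k : ℕ → ℕ := fun n => J (s n + t)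
  have hk : Tendsto k U atTop := hJ.comp hr
  have hks : Tendsto (fun n => s (k n) - s n) U (𝓝 t) := by
    have := (hJs.comp hr).add_const t
    rw [zero_add] at this
    refine this.congr fun n => ?_
    simp only [Function.comp, k]
    ring
  rcases lt_trichotomy t 0 with ht | rfl | ht
  · have hle : ∀ᶠ n in (U : Filter ℕ), k n ≤ n := by
      filter_upwards [hks.eventually_lt_const ht] with n hn
      by_contra! hlt
      linarith [h.mono hlt.le]
    obtain ⟨q, hq⟩ := exists_tendsto_of_mem_isCompact hK hzK U k
    have hks' : Tendsto (fun n => s n - s (k n)) U (𝓝 (-t)) :=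
      hks.neg.congr fun n => by ring
    have hpq : p = Φ (-t) q :=
      tendsto_nhds_unique hzp (h.tendsto_of_tendsto (k := id) hk hq hle hks')
    rw [hpq, ← Φ.map_add, add_neg_cancel, Φ.map_zero_apply]
    exact mem_limitSet_of_tendsto hk hq
  · rwa [Φ.map_zero_apply]
  · have hle : ∀ᶠ n in (U : Filter ℕ), n ≤ k n := by
      filter_upwards [hks.eventually_const_lt ht] with n hn
      by_contra! hlt
      linarith [h.mono hlt.le]
    exact mem_limitSet_of_tendsto hk (h.tendsto_of_tendsto (m := id) hU hzp hle hks)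

/-- The limit set is connected: a separation by open sets would make `z` jump infinitely often
from one of them to the other, but the jumps of `z` vanish along every convergent subsequence. -/
theorem isPreconnected_limitSet (h : IsAsymptoticPseudotrajectory Φ s z) {K : Set X}
    (hK : IsCompact K) (hzK : ∀ n, z n ∈ K) [T2Space X] : IsPreconnected (limitSet z) := by
  have hSK : IsCompact (limitSet z) := by
    refine hK.of_isClosed_subset (isClosed_limitSet z) fun p hp => ?_
    exact isClosed_iff_clusterPt.1 hK.isClosed p
      (hp.clusterPt.mono (le_principal_iff.2 (mem_map.2 (univ_mem' hzK))))
  rw [isPreconnected_iff_subset_of_disjoint_closed]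
  intro A B hA hB hAB hdisj
  by_contra! hcon
  obtain ⟨⟨q, hqS, hqA⟩, ⟨p, hpS, hpB⟩⟩ := And.imp Set.not_subset.1 Set.not_subset.1 hcon
  have hpA : p ∈ A := (hAB hpS).resolve_right hpB
  have hqB : q ∈ B := (hAB hqS).resolve_left hqA
  obtain ⟨V, W, hV, hW, hAV, hBW, hVW⟩ := SeparatedNhds.of_isCompact_isCompact
    (hSK.inter_right hA) (hSK.inter_right hB)
    (Set.disjoint_left.2 fun x hx hx' => by
      have : x ∈ limitSet z ∩ (A ∩ B) := ⟨hx.1, hx.2, hx'.2⟩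
      rwa [hdisj] at this)
  -- every limit along an ultrafilter lies in `V` or in `W`
  have hS : ∀ x ∈ limitSet z, x ∈ V ∨ x ∈ W := fun x hx =>
    (hAB hx).imp (fun hxA => hAV ⟨hx, hxA⟩) fun hxB => hBW ⟨hx, hxB⟩
  have hfV : ∃ᶠ n in atTop, z n ∈ V := hpS.frequently (hV.mem_nhds (hAV ⟨hpS, hpA⟩))
  have hfW : ∃ᶠ n in atTop, z n ∈ W := hqS.frequently (hW.mem_nhds (hBW ⟨hqS, hqB⟩))
  have hjump : ∃ᶠ n in atTop, z n ∈ V ∧ z (n + 1) ∉ V := by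
    rw [frequently_atTop]
    intro N
    by_contra! hno
    obtain ⟨n, hn, hnV⟩ := frequently_atTop.1 hfV N
    have hall : ∀ k, n ≤ k → z k ∈ V := fun k hk =>
      Nat.le_induction hnV (fun j hj hjV => hno j (hn.trans hj) hjV) k hk
    obtain ⟨k, hk, hkW⟩ := frequently_atTop.1 hfW n
    exact Set.disjoint_left.1 hVW (hall k hk) hkW
  have := frequently_iff_neBot.1 hjump
  obtain ⟨U, hUle⟩ := Ultrafilter.exists_le (atTop ⊓ 𝓟 {n | z n ∈ V ∧ z (n + 1) ∉ V})
  have hU : (U : Filter ℕ) ≤ atTop := hUle.trans inf_le_left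
  have hUj : ∀ᶠ n in (U : Filter ℕ), z n ∈ V ∧ z (n + 1) ∉ V := hUle (mem_inf_of_right
    (mem_principal_self _))
  obtain ⟨x, hx⟩ := exists_tendsto_of_mem_isCompact hK hzK U id
  have hx' : Tendsto (fun n => z (n + 1)) U (𝓝 x) := by
    have := h.tendsto_of_tendsto (m := id) (k := fun n => n + 1) hU hx
      (Eventually.of_forall fun n => Nat.le_succ n) (h.tendsto_step.mono_left hU)
    rwa [Φ.map_zero_apply] at this
  rcases hS x (mem_limitSet_of_tendsto (m := id) hU hx) with hxV | hxW
  · obtain ⟨n, hn, hn'⟩ := ((hx'.eventually_mem (hV.mem_nhds hxV)).and hUj).exists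
    exact hn'.2 hn
  · obtain ⟨n, hn, hn'⟩ := ((hx.eventually_mem (hW.mem_nhds hxW)).and hUj).exists
    exact Set.disjoint_left.1 hVW hn'.1 hn

/-- Late points of an asymptotic pseudotrajectory that are at least `T` apart in time are joined
by a `(δ, T)`-pseudo-orbit, obtained by cutting the time between them into pieces of length
between `T` and `2 * T + 1`. -/
theorem exists_pseudoOrbit (h : IsAsymptoticPseudotrajectory Φ s z) {δ T : ℝ} (hδ : 0 < δ)
    (hT : 0 < T) : ∃ N, ∀ n, N ≤ n → ∀ m, T ≤ s m - s n →
      ∃ (k : ℕ) (y : ℕ → X) (t : ℕ → ℝ), 1 ≤ k ∧ (∀ i < k, T ≤ t i) ∧ y 0 = z n ∧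
        (∀ i < k, dist (Φ (t i) (y i)) (y (i + 1)) < δ) ∧ y k = z m := by
  obtain ⟨N₁, hN₁⟩ := h.shadow (2 * T + 1) δ hδ
  obtain ⟨J, hJ, hJs⟩ := exists_index_near h.mono h.tendsto_time h.tendsto_step
  obtain ⟨R, hR⟩ := eventually_atTop.1 (Metric.tendsto_nhds.1 hJs (1 / 2) one_half_pos)
  obtain ⟨N₂, hN₂⟩ := eventually_atTop.1 (h.tendsto_time.eventually_ge_atTop R)
  have hlt : ∀ {i j}, s i < s j → i < j := fun hij => h.mono.reflect_lt hij
  refine ⟨max N₁ N₂, fun n hn m => ?_⟩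
  induction m using Nat.strong_induction_on with
  | _ m ih =>
    intro hm
    rcases le_or_gt (s m - s n) (2 * T + 1) with hle | hgt
    · refine ⟨1, fun i => if i = 0 then z n else z m, fun _ => s m - s n, le_rfl,
        fun _ _ => hm, by simp, fun i hi => ?_, by simp⟩
      obtain rfl : i = 0 := by omega
      simpa [dist_comm] using hN₁ n m (le_of_max_le_left hn) (hlt (by linarith)).le hle
    · have hsR : R ≤ s n := hN₂ n (le_of_max_le_right hn)
      have hj := hR (s m - T - 1 / 2) (by linarith)
      set j := J (s m - T - 1 / 2)
      rw [Real.dist_eq, sub_zero, abs_lt] at hj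
      have hnj : n < j := hlt (by linarith)
      have hjm : j < m := hlt (by linarith)
      obtain ⟨k, y, t, hk, ht, hy0, hy, hyk⟩ := ih j hjm (by linarith)
      refine ⟨k + 1, Function.update y (k + 1) (z m), Function.update t k (s m - s j),
        by omega, fun i hi => ?_, ?_, fun i hi => ?_, by simp⟩
      · rcases eq_or_ne i k with rfl | hik
        · rw [Function.update_self]
          linarith
        · rw [Function.update_of_ne hik]
          exact ht i (by omega)
      · rw [Function.update_of_ne (by omega), hy0]
      · rw [Function.update_of_ne (a := i) (a' := k + 1) (by omega)]
        rcases eq_or_ne i k with rfl | hik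
        · rw [Function.update_self, Function.update_self, hyk, dist_comm]
          exact hN₁ j m ((le_of_max_le_left hn).trans hnj.le) hjm.le (by linarith)
        · rw [Function.update_of_ne hik, Function.update_of_ne (by omega)]
          exact hy i (by omega)

theorem limitSet_subset_chainRecurrentSet (h : IsAsymptoticPseudotrajectory Φ s z) :
    limitSet z ⊆ chainRecurrentSet Φ := by
  intro p hp δ hδ T hT
  obtain ⟨N, hN⟩ := h.exists_pseudoOrbit (half_pos hδ) hT
  have hfr := frequently_atTop.1 (MapClusterPt.frequently hp (Metric.ball_mem_nhds p (half_pos hδ)))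
  obtain ⟨n, hn, hnp⟩ := hfr N
  obtain ⟨M, hM⟩ := eventually_atTop.1 (h.tendsto_time.eventually_ge_atTop (s n + T))
  obtain ⟨m, hm, hmp⟩ := hfr M
  obtain ⟨k, y, t, hk, ht, hy0, hy, hyk⟩ := hN n hn m (by linarith [hM m hm])
  refine ⟨k, Function.update y k p, t, hk, ht, ?_, fun i hi => ?_, by simp⟩
  · rw [Function.update_of_ne (by omega), hy0]
    exact (Metric.mem_ball.1 hnp).trans (half_lt_self hδ)
  · rw [Function.update_of_ne (a := i) (a' := k) (by omega)]
    rcases eq_or_ne (i + 1) k with hik | hik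
    · rw [hik, Function.update_self]
      have h1 := hy i hi
      rw [hik, hyk] at h1
      linarith [dist_triangle (Φ (t i) (y i)) (z m) p, Metric.mem_ball.1 hmp]
    · rw [Function.update_of_ne hik]
      exact (hy i hi).trans (half_lt_self hδ)

/-- The limit set theorem for asymptotic pseudotrajectories with relatively compact range. -/
theorem isChainRecurrentContinuum [T2Space X] (h : IsAsymptoticPseudotrajectory Φ s z) {K : Set X}
    (hK : IsCompact K) (hzK : ∀ n, z n ∈ K) : IsChainRecurrentContinuum Φ (limitSet z) := by
  have hne : (limitSet z).Nonempty := by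
    obtain ⟨q, -, hq⟩ := hK.exists_mapClusterPt (f := atTop) (u := z)
      (le_principal_iff.2 (mem_map.2 (univ_mem' hzK)))
    exact ⟨q, hq⟩
  have hsub : limitSet z ⊆ K := fun p hp =>
    isClosed_iff_clusterPt.1 hK.isClosed p
      (hp.clusterPt.mono (le_principal_iff.2 (mem_map.2 (univ_mem' hzK))))
  refine ⟨hne, hK.of_isClosed_subset (isClosed_limitSet z) hsub,
    ⟨hne, h.isPreconnected_limitSet hK hzK⟩, fun t => ?_, h.limitSet_subset_chainRecurrentSet⟩
  refine Set.Subset.antisymm (Set.image_subset_iff.2 fun p hp => h.flow_mem_limitSet hK hzK hp t)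
    fun p hp => ⟨Φ (-t) p, h.flow_mem_limitSet hK hzK hp (-t), ?_⟩
  rw [← Φ.map_add, add_neg_cancel, Φ.map_zero_apply]

end IsAsymptoticPseudotrajectory

end LimitSet

/-! ### Perturbed Robbins–Monro sequences are asymptotic pseudotrajectories -/

section Shadowing

open scoped NNReal

/-- Error of one explicit Euler step along an integral curve of a Lipschitz vector field. -/
theorem norm_euler_step_le {E : Type*} [NormedAddCommGroup E] [NormedSpace ℝ E] {F : E → E}
    {K : ℝ≥0} (hF : LipschitzWith K F) {γ : ℝ → E} (hγ : ∀ t, HasDerivAt γ (F (γ t)) t) {M t h : ℝ}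
    (hh : 0 ≤ h) (hM : ∀ r ∈ Set.Icc t (t + h), ‖F (γ r)‖ ≤ M) :
    ‖γ (t + h) - γ t - h • F (γ t)‖ ≤ K * M * h ^ 2 := by
  have ht : t ∈ Set.Icc t (t + h) := ⟨le_rfl, by linarith⟩
  have hM0 : 0 ≤ M := (norm_nonneg _).trans (hM t ht)
  have hmove : ∀ r ∈ Set.Icc t (t + h), ‖γ r - γ t‖ ≤ M * h := fun r hr => by
    refine ((convex_Icc t (t + h)).norm_image_sub_le_of_norm_hasDerivWithin_le
      (fun x _ => (hγ x).hasDerivWithinAt) hM ht hr).trans ?_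
    rw [Real.norm_of_nonneg (by linarith [hr.1])]
    exact mul_le_mul_of_nonneg_left (by linarith [hr.2]) hM0
  have hder : ∀ x ∈ Set.Icc t (t + h), HasDerivWithinAt (fun r => γ r - r • F (γ t))
      (F (γ x) - F (γ t)) (Set.Icc t (t + h)) x := fun x _ => by
    have := ((hγ x).fun_sub ((hasDerivAt_id' x).smul_const (F (γ t)))).hasDerivWithinAt
      (s := Set.Icc t (t + h))
    rwa [one_smul] at this
  have := (convex_Icc t (t + h)).norm_image_sub_le_of_norm_hasDerivWithin_le (C := K * (M * h)) hder
    (fun x hx => by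
      rw [← dist_eq_norm]
      refine (hF.dist_le_mul _ _).trans (mul_le_mul_of_nonneg_left ?_ K.2)
      rw [dist_eq_norm]
      exact hmove x hx) ht (y := t + h) ⟨by linarith, le_rfl⟩
  rw [add_sub_cancel_left, Real.norm_of_nonneg hh] at this
  calc ‖γ (t + h) - γ t - h • F (γ t)‖
      = ‖γ (t + h) - (t + h) • F (γ t) - (γ t - t • F (γ t))‖ := by
        congr 1
        rw [add_smul]
        abel
    _ ≤ K * M * h ^ 2 := this.trans_eq (by ring)

variable {d : ℕ} {f : EuclideanSpace ℝ (Fin d) → ℝ} {L : ℝ} {a : ℕ → ℝ}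
  {z : ℕ → EuclideanSpace ℝ (Fin d)}

/-- Discrete Grönwall comparison of a perturbed Euler scheme, started at time `s n`, with an
integral curve `γ`: here `η` bounds the accumulated perturbations and `M * a k ≤ θ` the local
errors. -/
theorem norm_sub_integralCurve_le {E : Type*} [NormedAddCommGroup E] [NormedSpace ℝ E] {F : E → E}
    {K : ℝ≥0} (hF : LipschitzWith K F) {γ : ℝ → E} (hγ : ∀ t, HasDerivAt γ (F (γ t)) t)
    {s a : ℕ → ℝ} {z w : ℕ → E} {n m : ℕ} {M T η θ : ℝ} (hM : ∀ r ∈ Set.Icc 0 T, ‖F (γ r)‖ ≤ M)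
    (hs : ∀ k, n ≤ k → s (k + 1) = s k + a k) (ha : ∀ k, n ≤ k → 0 ≤ a k)
    (hz : ∀ k, n ≤ k → z (k + 1) = z k + a k • (F (z k) + w k)) (hzn : z n = γ 0)
    (hT : ∀ k, n ≤ k → k ≤ m → s k - s n ∈ Set.Icc 0 T)
    (hw : ∀ k, n ≤ k → k ≤ m → ‖∑ i ∈ Finset.Ico n k, a i • w i‖ ≤ η)
    (hθ : ∀ k, n ≤ k → M * a k ≤ θ) (hη0 : 0 ≤ η) (hθ0 : 0 ≤ θ) (hnm : n ≤ m) :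
    ‖z m - γ (s m - s n)‖ ≤ (η + θ) * Real.exp (K * T) + η := by
  set D : ℕ → E := fun k => z k - γ (s k - s n) - ∑ i ∈ Finset.Ico n k, a i • w i with hD
  have hzγ : ∀ k, n ≤ k → k ≤ m → ‖z k - γ (s k - s n)‖ ≤ ‖D k‖ + η := fun k hk hkm => by
    have h1 := norm_add_le (D k) (∑ i ∈ Finset.Ico n k, a i • w i)
    rw [hD, sub_add_cancel] at h1
    linarith [hw k hk hkm]
  have main : ∀ k, n ≤ k → k ≤ m →
      ‖D k‖ + (η + θ) ≤ (η + θ) * Real.exp (K * (s k - s n)) := by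
    intro k hk
    induction k, hk using Nat.le_induction with
    | base => simp [hD, hzn]
    | succ k hk ih =>
      intro hkm
      have ih := ih (by omega)
      have h1 := hT k hk (by omega)
      have h2 := hT (k + 1) (by omega) hkm
      have hsk : s (k + 1) - s n = s k - s n + a k := by rw [hs k hk]; ring
      have hE := norm_euler_step_le hF hγ (ha k hk) (M := M) (t := s k - s n)
        fun r hr => hM r ⟨h1.1.trans hr.1, hr.2.trans (hsk ▸ h2.2)⟩
      have hstep : D (k + 1) = D k + a k • (F (z k) - F (γ (s k - s n))) -
          (γ (s k - s n + a k) - γ (s k - s n) - a k • F (γ (s k - s n))) := by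
        simp only [hD]
        rw [Finset.sum_Ico_succ_top hk, hsk, hz k hk, smul_add, smul_sub]
        abel
      have h3 : ‖a k • (F (z k) - F (γ (s k - s n)))‖ ≤ a k * (K * (‖D k‖ + η)) := by
        rw [norm_smul, Real.norm_of_nonneg (ha k hk), ← dist_eq_norm]
        refine mul_le_mul_of_nonneg_left ((hF.dist_le_mul _ _).trans ?_) (ha k hk)
        rw [dist_eq_norm]
        exact mul_le_mul_of_nonneg_left (hzγ k hk (by omega)) K.2
      have h4 : K * M * a k ^ 2 ≤ a k * (K * θ) := by
        have := mul_le_mul_of_nonneg_left (hθ k hk) (mul_nonneg K.coe_nonneg (ha k hk))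
        linarith
      have h5 : ‖D (k + 1)‖ ≤ ‖D k‖ + a k * (K * (‖D k‖ + η)) + a k * (K * θ) := by
        rw [hstep]
        refine (norm_sub_le _ _).trans (add_le_add ((norm_add_le _ _).trans ?_) (hE.trans h4))
        linarith
      calc ‖D (k + 1)‖ + (η + θ) ≤ (‖D k‖ + (η + θ)) * (K * a k + 1) := by nlinarith
        _ ≤ ((η + θ) * Real.exp (K * (s k - s n))) * Real.exp (K * a k) := by
          exact mul_le_mul ih (Real.add_one_le_exp _)
            (add_nonneg (mul_nonneg K.coe_nonneg (ha k hk)) zero_le_one) (by positivity)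
        _ = (η + θ) * Real.exp (K * (s (k + 1) - s n)) := by
          rw [hsk, mul_add (K : ℝ), Real.exp_add]
          ring
  have h1 := main m hnm le_rfl
  have h2 : Real.exp (K * (s m - s n)) ≤ Real.exp (K * T) :=
    Real.exp_le_exp.2 (mul_le_mul_of_nonneg_left (hT m hnm le_rfl).2 K.2)
  nlinarith [hzγ m hnm le_rfl, mul_le_mul_of_nonneg_left h2 (add_nonneg hη0 hθ0)]

theorem IsBoundedPerturbedRM.isAsymptoticPseudotrajectory (h : IsBoundedPerturbedRM f a z)
    (hf : IsLSmooth f L) {Φ : Flow ℝ (EuclideanSpace ℝ (Fin d))} (hΦ : IsGradientFlow f Φ) :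
    IsAsymptoticPseudotrajectory Φ (fun n => ∑ i ∈ Finset.Ico 1 n, a i) z := by
  obtain ⟨hpos, htop, ha0, hbdd, u, b, hrec, hb, hu⟩ := h
  set s : ℕ → ℝ := fun n => ∑ i ∈ Finset.Ico 1 n, a i with hs
  have hsucc : ∀ n, 1 ≤ n → s (n + 1) = s n + a n := fun n hn =>
    Finset.sum_Ico_succ_top hn a
  have hτ : ∀ n, ∑ i ∈ Finset.Icc 1 n, a i = s (n + 1) := fun n => by
    simp only [hs]
    congr 1
  have hmono : Monotone s := monotone_nat_of_le_succ fun n => by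
    rcases Nat.eq_zero_or_pos n with rfl | hn
    · simp [hs]
    · linarith [hsucc n hn, hpos n hn]
  refine ⟨hmono, ?_, ?_, fun T ε hε => ?_⟩
  · refine (tendsto_add_atTop_iff_nat 1).1 ?_
    simpa only [hτ] using htop
  · refine ha0.congr' ?_
    filter_upwards [eventually_ge_atTop 1] with n hn
    rw [hsucc n hn]
    ring
  · set T' : ℝ := |T| + 1 with hT'
    have hT'pos : 0 < T' := by positivity
    -- a bound for the gradient along the relevant pieces of orbits
    obtain ⟨M, hM⟩ : ∃ M, ∀ r ∈ Set.Icc 0 T', ∀ n, ‖-gradient f (Φ r (z n))‖ ≤ M := by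
      have hc : IsCompact (Set.Icc 0 T' ×ˢ closure (Set.range z)) :=
        isCompact_Icc.prod hbdd.isCompact_closure
      obtain ⟨M, hM⟩ := hc.exists_bound_of_continuousOn
        (f := fun p : ℝ × EuclideanSpace ℝ (Fin d) => -gradient f (Φ p.1 p.2))
        (hf.continuous_gradient.comp Φ.cont').neg.continuousOn
      exact ⟨M, fun r hr n => hM (r, z n) ⟨hr, subset_closure ⟨n, rfl⟩⟩⟩
    have hM0 : 0 ≤ M := (norm_nonneg _).trans (hM 0 ⟨le_rfl, hT'pos.le⟩ 0)
    set C := (1 + T' + M) * Real.exp (L.toNNReal * T') + (1 + T') with hC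
    have hC0 : 0 < C := by positivity
    set η := ε / (2 * C) with hη
    have hη0 : 0 < η := by positivity
    obtain ⟨N₁, hN₁⟩ := hu T' hT'pos η hη0
    obtain ⟨N₂, hN₂⟩ := eventually_atTop.1
      (((tendsto_zero_iff_norm_tendsto_zero.1 hb).eventually_le_const hη0).and
        ((ha0.eventually_le_const hη0).and (ha0.eventually_le_const one_pos)))
    refine ⟨max 1 (max N₁ N₂), fun n m hn hnm hT => ?_⟩
    have hn1 : 1 ≤ n := le_of_max_le_left hn
    have hnN₁ : N₁ ≤ n := le_of_max_le_left (le_of_max_le_right hn)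
    have hnN₂ : N₂ ≤ n := le_of_max_le_right (le_of_max_le_right hn)
    have hTk : ∀ k, n ≤ k → k ≤ m → s k - s n ∈ Set.Icc 0 (T' - 1) := fun k hk hkm =>
      ⟨sub_nonneg.2 (hmono hk), by linarith [hmono hkm, le_abs_self T]⟩
    have hw : ∀ k, n ≤ k → k ≤ m →
        ‖∑ i ∈ Finset.Ico n k, a i • (u i + b i)‖ ≤ η * (1 + T') := by
      intro k hk hkm
      have hu' : ‖∑ i ∈ Finset.Ico n k, a i • u i‖ ≤ η := by
        refine hN₁ n k hnN₁ hn1 ?_ ?_ <;> rw [hτ, hτ]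
        · exact sub_nonneg.2 (hmono (by omega))
        · linarith [hsucc n hn1, hsucc k (hn1.trans hk), hpos n hn1,
            (hN₂ k (hnN₂.trans hk)).2.2, (hTk k hk hkm).2]
      have hb' : ‖∑ i ∈ Finset.Ico n k, a i • b i‖ ≤ η * T' := by
        calc ‖∑ i ∈ Finset.Ico n k, a i • b i‖ ≤ ∑ i ∈ Finset.Ico n k, a i * η := by
              refine norm_sum_le_of_le _ fun i hi => ?_
              have hi' := (Finset.mem_Ico.1 hi).1
              have hai := (hpos i (hn1.trans hi')).le
              rw [norm_smul, Real.norm_of_nonneg hai]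
              exact mul_le_mul_of_nonneg_left (hN₂ i (hnN₂.trans hi')).1 hai
          _ = (s k - s n) * η := by
              have := Finset.sum_Ico_consecutive a hn1 hk
              rw [← Finset.sum_mul, ← sub_eq_of_eq_add' this.symm]
          _ ≤ η * T' := by nlinarith [(hTk k hk hkm).2]
      calc ‖∑ i ∈ Finset.Ico n k, a i • (u i + b i)‖
          = ‖∑ i ∈ Finset.Ico n k, a i • u i + ∑ i ∈ Finset.Ico n k, a i • b i‖ := by
            simp only [smul_add, Finset.sum_add_distrib]
        _ ≤ η * (1 + T') := (norm_add_le _ _).trans (by linarith)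
    have hfin := norm_sub_integralCurve_le hf.lipschitzWith_neg_gradient (hΦ (z n)) (s := s)
      (a := a) (z := z) (w := fun i => u i + b i) (n := n) (m := m) (M := M) (T := T')
      (η := η * (1 + T')) (θ := M * η) (fun r hr => hM r hr n)
      (fun k hk => hsucc k (hn1.trans hk)) (fun k hk => (hpos k (hn1.trans hk)).le)
      (fun k hk => by rw [hrec k (hn1.trans hk), add_assoc]) (by simp)
      (fun k hk hkm => ⟨(hTk k hk hkm).1, by linarith [(hTk k hk hkm).2]⟩) hw
      (fun k hk => mul_le_mul_of_nonneg_left (hN₂ k (hnN₂.trans hk)).2.1 hM0)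
      (by positivity) (by positivity) hnm
    rw [dist_eq_norm]
    calc ‖z m - Φ (s m - s n) (z n)‖ ≤ η * C := hfin.trans_eq (by rw [hC]; ring)
      _ = ε / 2 := by rw [hη]; field_simp
      _ < ε := half_lt_self hε

/-- The limit set theorem for bounded perturbed Robbins–Monro sequences. -/
theorem IsBoundedPerturbedRM.isChainRecurrentContinuum (h : IsBoundedPerturbedRM f a z)
    (hf : IsLSmooth f L) {Φ : Flow ℝ (EuclideanSpace ℝ (Fin d))} (hΦ : IsGradientFlow f Φ) :
    IsChainRecurrentContinuum Φ (limitSet z) :=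
  (h.isAsymptoticPseudotrajectory hf hΦ).isChainRecurrentContinuum
    h.2.2.2.1.isCompact_closure fun n => subset_closure ⟨n, rfl⟩

end Shadowing

/-! ### A maximal inequality and its consequences -/

section Maximal

open scoped ENNReal

variable {Ω : Type*} {m mΩ : MeasurableSpace Ω} {P : Measure Ω}

/-- If `ξ` is independent of `m` and `X` is `m`-measurable, then integrating out `ξ` with `X`
frozen computes integrals over events of `m`. -/
theorem setLIntegral_freeze {Ξ S : Type*} [MeasurableSpace Ξ] [MeasurableSpace S]
    [IsProbabilityMeasure P] {ν : Measure Ξ} (hm : m ≤ mΩ) {ξ : Ω → Ξ}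
    (hξ : Measurable ξ) (hind : Indep (MeasurableSpace.comap ξ inferInstance) m P)
    (hlaw : P.map ξ = ν) {X : Ω → S} (hX : Measurable[m] X) {φ : S → Ξ → ℝ≥0∞}
    (hφ : Measurable (Function.uncurry φ)) {B : Set Ω} (hB : MeasurableSet[m] B) :
    ∫⁻ ω in B, φ (X ω) (ξ ω) ∂P = ∫⁻ ω in B, ∫⁻ s, φ (X ω) s ∂ν ∂P := by
  -- the event `B` is recorded, through its indicator, as a second frozen variable
  let Y : Ω → S × ℝ≥0∞ := fun ω => (X ω, B.indicator 1 ω)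
  have hY : Measurable[m] Y := hX.prodMk
    ((measurable_const : Measurable[m] fun _ => (1 : ℝ≥0∞)).indicator hB)
  have hY' : Measurable Y := hY.mono hm le_rfl
  have hprob : IsProbabilityMeasure ν := hlaw ▸ Measure.isProbabilityMeasure_map hξ.aemeasurable
  have hindep : IndepFun Y ξ P :=
    (IndepFun_iff_Indep Y ξ P).2 (indep_of_indep_of_le_left hind.symm hY.comap_le)
  have hmap : P.map (fun ω => (Y ω, ξ ω)) = (P.map Y).prod ν := by
    rw [(indepFun_iff_map_prod_eq_prod_map_map hY'.aemeasurable hξ.aemeasurable).1 hindep, hlaw]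
  have hψ : Measurable fun p : (S × ℝ≥0∞) × Ξ => p.1.2 * φ p.1.1 p.2 :=
    measurable_fst.snd.mul (hφ.comp (measurable_fst.fst.prodMk measurable_snd))
  have hindicator : ∀ g : Ω → ℝ≥0∞,
      ∫⁻ ω in B, g ω ∂P = ∫⁻ ω, B.indicator 1 ω * g ω ∂P := fun g => by
    rw [← lintegral_indicator (hm _ hB)]
    refine lintegral_congr fun ω => ?_
    by_cases h : ω ∈ B <;> simp [h]
  rw [hindicator, hindicator]
  calc ∫⁻ ω, B.indicator 1 ω * φ (X ω) (ξ ω) ∂P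
      = ∫⁻ p, p.1.2 * φ p.1.1 p.2 ∂(P.map fun ω => (Y ω, ξ ω)) := by
        rw [lintegral_map hψ (hY'.prodMk hξ)]
    _ = ∫⁻ y, ∫⁻ s, y.2 * φ y.1 s ∂ν ∂(P.map Y) := by
        rw [hmap, lintegral_prod _ hψ.aemeasurable]
    _ = ∫⁻ ω, ∫⁻ s, B.indicator 1 ω * φ (X ω) s ∂ν ∂P := by
        rw [lintegral_map hψ.lintegral_prod_right' hY']
    _ = ∫⁻ ω, B.indicator 1 ω * ∫⁻ s, φ (X ω) s ∂ν ∂P := by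
        refine lintegral_congr fun ω => ?_
        exact lintegral_const_mul _ (hφ.comp measurable_prodMk_left)

/-- Doob's maximal inequality for a nonnegative supermartingale `U`, in a form that needs no
integrability: the supermartingale property is expressed by integrals over past events. -/
theorem maximal_inequality {ℱ : Filtration ℕ mΩ} {U : ℕ → Ω → ℝ≥0∞} {N : ℕ}
    (hU : ∀ n, N ≤ n → Measurable[ℱ n] (U n))
    (hstep : ∀ n, N ≤ n → ∀ B, MeasurableSet[ℱ n] B →
      ∫⁻ ω in B, U (n + 1) ω ∂P ≤ ∫⁻ ω in B, U n ω ∂P)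
    {H : Set Ω} (hH : MeasurableSet[ℱ N] H) (r : ℝ≥0∞) :
    r * P (H ∩ {ω | ∃ n, N ≤ n ∧ r ≤ U n ω}) ≤ ∫⁻ ω in H, U N ω ∂P := by
  let B : ℕ → Set Ω := fun n => H ∩ {ω | ∀ i, N ≤ i → i < n → U i ω < r}
  have hBanti : Antitone B := fun i j hij ω hω =>
    ⟨hω.1, fun k hk hki => hω.2 k hk (hki.trans_le hij)⟩
  have hBsucc : ∀ n, N ≤ n → B (n + 1) = B n ∩ {ω | U n ω < r} := fun n hn => by
    ext ω
    constructor
    · exact fun hω => ⟨hBanti (Nat.le_succ n) hω, hω.2 n hn (Nat.lt_succ_self n)⟩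
    · exact fun hω => ⟨hω.1.1, fun i hi hin => (Nat.lt_succ_iff_lt_or_eq.1 hin).elim
        (hω.1.2 i hi) fun h => h ▸ hω.2⟩
  have hBN : B N = H := by
    ext ω
    exact ⟨fun hω => hω.1, fun hω => ⟨hω, fun i hi hiN => absurd hiN (not_lt.2 hi)⟩⟩
  have hlt : ∀ n, N ≤ n → MeasurableSet[ℱ n] {ω | U n ω < r} := fun n hn =>
    hU n hn measurableSet_Iio
  have hBmeas : ∀ n, N ≤ n → MeasurableSet[ℱ n] (B n) := by
    intro n hn
    induction n, hn using Nat.le_induction with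
    | base => rwa [hBN]
    | succ n hn ih =>
      rw [hBsucc n hn]
      exact ℱ.mono (Nat.le_succ n) _ (ih.inter (hlt n hn))
  have main : ∀ n, N ≤ n → r * P (H \ B n) + ∫⁻ ω in B n, U n ω ∂P ≤ ∫⁻ ω in H, U N ω ∂P := by
    intro n hn
    induction n, hn using Nat.le_induction with
    | base => simp [hBN]
    | succ n hn ih =>
      have hB' : MeasurableSet (B (n + 1)) := ℱ.le _ _ (hBmeas (n + 1) (by omega))
      set C := B n \ B (n + 1) with hC
      have hCr : r * P C ≤ ∫⁻ ω in C, U n ω ∂P := by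
        rw [← setLIntegral_const]
        refine setLIntegral_mono' ((ℱ.le _ _ (hBmeas n hn)).diff hB') fun ω hω => ?_
        by_contra! h
        exact hω.2 ((hBsucc n hn).symm ▸ ⟨hω.1, h⟩)
      have hsplit : ∫⁻ ω in B n, U n ω ∂P =
          ∫⁻ ω in B (n + 1), U n ω ∂P + ∫⁻ ω in C, U n ω ∂P := by
        have h1 := lintegral_inter_add_sdiff (μ := P) (U n) (B n) hB'
        rwa [Set.inter_eq_right.2 (hBanti (Nat.le_succ n)), eq_comm] at h1
      have hmeas : P (H \ B (n + 1)) ≤ P (H \ B n) + P C := by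
        refine (measure_mono fun ω hω => ?_).trans (measure_union_le _ _)
        by_cases h : ω ∈ B n
        · exact Or.inr ⟨h, hω.2⟩
        · exact Or.inl ⟨hω.1, h⟩
      have hnext : ∫⁻ ω in B (n + 1), U (n + 1) ω ∂P ≤ ∫⁻ ω in B (n + 1), U n ω ∂P := by
        refine hstep n hn _ ?_
        rw [hBsucc n hn]
        exact (hBmeas n hn).inter (hlt n hn)
      calc r * P (H \ B (n + 1)) + ∫⁻ ω in B (n + 1), U (n + 1) ω ∂P
          ≤ r * (P (H \ B n) + P C) + ∫⁻ ω in B (n + 1), U n ω ∂P := by gcongr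
        _ = r * P (H \ B n) + (∫⁻ ω in B (n + 1), U n ω ∂P + r * P C) := by ring
        _ ≤ r * P (H \ B n) + ∫⁻ ω in B n, U n ω ∂P := by
          rw [hsplit]
          gcongr
        _ ≤ _ := ih
  have hset : H ∩ {ω | ∃ n, N ≤ n ∧ r ≤ U n ω} ⊆ ⋃ n, H \ B n := by
    rintro ω ⟨hω, n, hn, hr⟩
    exact Set.mem_iUnion.2 ⟨n + 1, hω, fun h => not_lt.2 hr (h.2 n hn (Nat.lt_succ_self n))⟩
  have hmono : Monotone fun n => H \ B n := fun i j hij => Set.sdiff_subset_sdiff_right (hBanti hij)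
  calc r * P (H ∩ {ω | ∃ n, N ≤ n ∧ r ≤ U n ω}) ≤ r * P (⋃ n, H \ B n) := by gcongr
    _ = ⨆ n, r * P (H \ B n) := by rw [hmono.measure_iUnion, ENNReal.mul_iSup]
    _ ≤ _ := iSup_le fun n => by
      refine le_trans ?_ (main (max n N) (le_max_right _ _))
      exact (mul_le_mul_right (measure_mono (hmono (le_max_left n N))) r).trans le_self_add

/-- Almost sure boundedness in the manner of Robbins and Siegmund: a nonnegative adapted process
whose conditional expectations grow by factors `1 + c n` with `∑ c n < ∞` is almost surely
bounded. Dividing by the partial products of these factors gives a supermartingale. -/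
theorem ae_bounded_of_almost_supermartingale {ℱ : Filtration ℕ mΩ} {V : ℕ → Ω → ℝ≥0∞} {N : ℕ}
    [IsProbabilityMeasure P] (hV : ∀ n, N ≤ n → Measurable[ℱ n] (V n)) (hVN : ∀ ω, V N ω ≠ ∞)
    {c : ℕ → ℝ} (hc0 : ∀ n, 0 ≤ c n) (hc : Summable c)
    (hstep : ∀ n, N ≤ n → ∀ B, MeasurableSet[ℱ n] B →
      ∫⁻ ω in B, V (n + 1) ω ∂P ≤ ENNReal.ofReal (1 + c n) * ∫⁻ ω in B, V n ω ∂P) :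
    ∀ᵐ ω ∂P, ∃ M : ℝ, ∀ n, N ≤ n → V n ω ≤ ENNReal.ofReal M := by
  set Q : ℕ → ℝ := fun n => ∏ i ∈ Finset.range n, (1 + c i) with hQ
  have hQ1 : ∀ n, 0 < Q n := fun n => Finset.prod_pos fun i _ => by linarith [hc0 i]
  set R : ℝ := Real.exp (∑' i, c i) with hR
  have hQR : ∀ n, Q n ≤ R := fun n => by
    calc Q n ≤ ∏ i ∈ Finset.range n, Real.exp (c i) :=
          Finset.prod_le_prod (fun i _ => by linarith [hc0 i])
            fun i _ => by linarith [Real.add_one_le_exp (c i)]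
      _ = Real.exp (∑ i ∈ Finset.range n, c i) := (Real.exp_sum _ _).symm
      _ ≤ R := Real.exp_le_exp.2 (hc.sum_le_tsum _ fun i _ => hc0 i)
  set U : ℕ → Ω → ℝ≥0∞ := fun n ω => ENNReal.ofReal (Q n)⁻¹ * V n ω with hU
  have hUmeas : ∀ n, N ≤ n → Measurable[ℱ n] (U n) := fun n hn => (hV n hn).const_mul _
  have hUstep : ∀ n, N ≤ n → ∀ B, MeasurableSet[ℱ n] B →
      ∫⁻ ω in B, U (n + 1) ω ∂P ≤ ∫⁻ ω in B, U n ω ∂P := by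
    intro n hn B hB
    simp only [hU]
    rw [lintegral_const_mul' _ _ ENNReal.ofReal_ne_top,
      lintegral_const_mul' _ _ ENNReal.ofReal_ne_top]
    calc ENNReal.ofReal (Q (n + 1))⁻¹ * ∫⁻ ω in B, V (n + 1) ω ∂P
        ≤ ENNReal.ofReal (Q (n + 1))⁻¹ *
          (ENNReal.ofReal (1 + c n) * ∫⁻ ω in B, V n ω ∂P) := by
          gcongr
          exact hstep n hn B hB
      _ = ENNReal.ofReal (Q n)⁻¹ * ∫⁻ ω in B, V n ω ∂P := by
          have h1 : 0 < 1 + c n := by linarith [hc0 n]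
          rw [← mul_assoc, ← ENNReal.ofReal_mul (inv_nonneg.2 (hQ1 _).le)]
          congr 2
          simp only [hQ]
          rw [Finset.prod_range_succ, mul_inv, mul_assoc, inv_mul_cancel₀ h1.ne', mul_one]
  have hK : ∀ K : ℕ, ∀ᵐ ω ∂P, V N ω ≤ K → ∃ M : ℝ, ∀ n, N ≤ n → V n ω ≤ ENNReal.ofReal M := by
    intro K
    have hHm : MeasurableSet[ℱ N] {ω | V N ω ≤ K} :=
      hV N le_rfl measurableSet_Iic
    have hUN : ∫⁻ ω in {ω | V N ω ≤ K}, U N ω ∂P ≤ ENNReal.ofReal (Q N)⁻¹ * K := by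
      calc ∫⁻ ω in {ω | V N ω ≤ K}, U N ω ∂P
          ≤ ∫⁻ ω in {ω | V N ω ≤ K}, ENNReal.ofReal (Q N)⁻¹ * K ∂P :=
            setLIntegral_mono' (ℱ.le _ _ hHm) fun ω hω => by
              simp only [hU]
              gcongr
              exact hω
        _ ≤ _ := by
            rw [setLIntegral_const]
            exact mul_le_of_le_one_right' prob_le_one
    set D : Set Ω := {ω | ¬(V N ω ≤ K → ∃ M : ℝ, ∀ n, N ≤ n → V n ω ≤ ENNReal.ofReal M)} with hD
    change P D = 0
    have hbound : ∀ j : ℕ, (j : ℝ≥0∞) * P D ≤ ENNReal.ofReal (Q N)⁻¹ * K := by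
      intro j
      refine le_trans ?_ ((maximal_inequality hUmeas hUstep hHm j).trans hUN)
      gcongr
      intro ω hω
      simp only [hD, Set.mem_ofPred_eq, Classical.not_imp, not_exists, not_forall, not_le] at hω
      obtain ⟨n, hn, hlt⟩ := hω.2 (j * R)
      refine ⟨hω.1, n, hn, ?_⟩
      calc (j : ℝ≥0∞) = ENNReal.ofReal (Q n)⁻¹ * ENNReal.ofReal (j * Q n) := by
            rw [← ENNReal.ofReal_mul (inv_nonneg.2 (hQ1 n).le), mul_comm (j : ℝ),
              inv_mul_cancel_left₀ (hQ1 n).ne', ENNReal.ofReal_natCast]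
        _ ≤ U n ω := by
            refine mul_le_mul_right ((ENNReal.ofReal_le_ofReal ?_).trans hlt.le) _
            exact mul_le_mul_of_nonneg_left (hQR n) j.cast_nonneg
    by_contra hne
    obtain ⟨j, hj⟩ := ENNReal.exists_nat_mul_gt hne
      (ENNReal.mul_ne_top ENNReal.ofReal_ne_top (ENNReal.natCast_ne_top K)
        : ENNReal.ofReal (Q N)⁻¹ * K ≠ ∞)
    exact absurd (hbound j) (not_le.2 hj)
  filter_upwards [ae_all_iff.2 hK] with ω hω
  obtain ⟨K, hKω⟩ := ENNReal.exists_nat_gt (hVN ω)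
  exact hω K hKω.le

/-- Convergence of square-summable martingales: centred increments `ψ n (X n) (ξ n)`, with `X n`
known at time `n`, `ξ n` independent of the past, and second moments bounded by a summable
sequence `c`. For fixed `N`, the process `‖M n - M N‖ ^ 2 + ∑ i ≥ n, c i` is a nonnegative
supermartingale, to which the maximal inequality applies. -/
theorem ae_cauchySeq_sum_of_centred {Ξ S E : Type*} [MeasurableSpace Ξ] [MeasurableSpace S]
    [NormedAddCommGroup E] [InnerProductSpace ℝ E] [CompleteSpace E] [MeasurableSpace E]
    [BorelSpace E] [SecondCountableTopology E] [IsProbabilityMeasure P] {ν : Measure Ξ}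
    [IsProbabilityMeasure ν] {ℱ : Filtration ℕ mΩ} {ξ : ℕ → Ω → Ξ} (hξ : IsSampling P ℱ ν ξ)
    {X : ℕ → Ω → S} (hX : ∀ n, 1 ≤ n → Measurable[ℱ n] (X n)) {ψ : ℕ → S → Ξ → E}
    (hψ : ∀ n, Measurable (Function.uncurry (ψ n))) (hint : ∀ n x, Integrable (ψ n x) ν)
    (hint2 : ∀ n x, Integrable (fun s => ‖ψ n x s‖ ^ 2) ν) (hzero : ∀ n x, ∫ s, ψ n x s ∂ν = 0)
    {c : ℕ → ℝ} (hc0 : ∀ n, 0 ≤ c n) (hc : Summable c)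
    (hsq : ∀ n x, ∫ s, ‖ψ n x s‖ ^ 2 ∂ν ≤ c n) :
    ∀ᵐ ω ∂P, CauchySeq fun n => ∑ i ∈ Finset.Ico 1 n, ψ i (X i ω) (ξ i ω) := by
  set M : ℕ → Ω → E := fun n ω => ∑ i ∈ Finset.Ico 1 n, ψ i (X i ω) (ξ i ω) with hMdef
  have hM : ∀ n, Measurable[ℱ n] (M n) := fun n => by
    refine @Finset.measurable_fun_sum _ _ _ _ _ _ (ℱ n) _ _ fun i hi => ?_
    obtain ⟨hi1, hin⟩ := Finset.mem_Ico.1 hi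
    have hXi : Measurable[ℱ n] (X i) := (hX i hi1).mono (ℱ.mono hin.le) le_rfl
    have hξi : Measurable[ℱ n] (ξ i) := (hξ.adapted i hi1).mono (ℱ.mono hin) le_rfl
    exact (hψ i).comp (hXi.prodMk hξi)
  have hMsucc : ∀ n, 1 ≤ n → ∀ ω, M (n + 1) ω = M n ω + ψ n (X n ω) (ξ n ω) := fun n hn ω =>
    Finset.sum_Ico_succ_top hn _
  set τ : ℕ → ℝ := fun n => ∑' i, c (i + n) with hτ
  have hτ0 : ∀ n, 0 ≤ τ n := fun n => tsum_nonneg fun i => hc0 _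
  have hτsucc : ∀ n, τ n = c n + τ (n + 1) := fun n => by
    simp only [hτ]
    rw [((summable_nat_add_iff n).2 hc).tsum_eq_zero_add, zero_add]
    simp only [add_assoc, add_comm 1 n]
  have hτlim : Tendsto τ atTop (𝓝 0) := tendsto_sum_nat_add c
  let U : ℕ → ℕ → Ω → ℝ≥0∞ := fun N n ω => ENNReal.ofReal (‖M n ω - M N ω‖ ^ 2 + τ n)
  have hsub : ∀ N n, N ≤ n → Measurable[ℱ n] fun ω => M n ω - M N ω := fun N n hn => by
    have hMN : Measurable[ℱ n] (M N) := (hM N).mono (ℱ.mono hn) le_rfl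
    exact (hM n).sub hMN
  have hUmeas : ∀ N n, N ≤ n → Measurable[ℱ n] (U N n) := fun N n hn => by
    have : Measurable fun e : E => ENNReal.ofReal (‖e‖ ^ 2 + τ n) := by fun_prop
    exact this.comp (hsub N n hn)
  -- the second moment of a translated centred increment
  have hmoment : ∀ n x m, ∫⁻ s, ENNReal.ofReal (‖m + ψ n x s‖ ^ 2 + τ (n + 1)) ∂ν ≤
      ENNReal.ofReal (‖m‖ ^ 2 + τ n) := fun n x m => by
    have hexp : ∀ s, ‖m + ψ n x s‖ ^ 2 + τ (n + 1) =
        (‖m‖ ^ 2 + τ (n + 1)) + (2 * inner ℝ m (ψ n x s) + ‖ψ n x s‖ ^ 2) := fun s => by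
      rw [norm_add_sq_real]
      ring
    have h1 : Integrable (fun s => 2 * inner ℝ m (ψ n x s)) ν :=
      ((hint n x).const_inner m).const_mul 2
    have h2 : Integrable (fun s => 2 * inner ℝ m (ψ n x s) + ‖ψ n x s‖ ^ 2) ν :=
      h1.add (hint2 n x)
    have h3 : Integrable (fun s => ‖m + ψ n x s‖ ^ 2 + τ (n + 1)) ν := by
      simp only [hexp]
      exact (integrable_const _).add h2
    rw [← ofReal_integral_eq_lintegral_ofReal h3
      (Eventually.of_forall fun s => add_nonneg (sq_nonneg _) (hτ0 _))]
    refine ENNReal.ofReal_le_ofReal ?_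
    simp only [hexp]
    rw [integral_add (integrable_const _) h2, integral_add h1 (hint2 n x), integral_const_mul,
      integral_inner (hint n x), hzero, inner_zero_right, integral_const, probReal_univ, one_smul,
      hτsucc n]
    linarith [hsq n x]
  have hUstep : ∀ N n, 1 ≤ N → N ≤ n → ∀ B, MeasurableSet[ℱ n] B →
      ∫⁻ ω in B, U N (n + 1) ω ∂P ≤ ∫⁻ ω in B, U N n ω ∂P := by
    intro N n hN hn B hB
    have hn1 := hN.trans hn
    have hY : Measurable[ℱ n] fun ω => (M n ω - M N ω, X n ω) :=
      (hsub N n hn).prodMk (hX n hn1)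
    have hφ : Measurable (Function.uncurry fun (p : E × S) (s : Ξ) =>
        ENNReal.ofReal (‖p.1 + ψ n p.2 s‖ ^ 2 + τ (n + 1))) :=
      (((measurable_fst.fst.add ((hψ n).comp (measurable_fst.snd.prodMk
        measurable_snd))).norm.pow_const 2).add_const _).ennreal_ofReal
    calc ∫⁻ ω in B, U N (n + 1) ω ∂P
        = ∫⁻ ω in B, ENNReal.ofReal
            (‖(M n ω - M N ω) + ψ n (X n ω) (ξ n ω)‖ ^ 2 + τ (n + 1)) ∂P := by
          refine lintegral_congr fun ω => ?_
          simp only [U, hMsucc n hn1]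
          rw [add_sub_right_comm]
      _ = ∫⁻ ω in B, ∫⁻ s, ENNReal.ofReal
            (‖(M n ω - M N ω) + ψ n (X n ω) s‖ ^ 2 + τ (n + 1)) ∂ν ∂P :=
          setLIntegral_freeze (ℱ.le n) (fun _ ht => ℱ.le (n + 1) _ (hξ.adapted n hn1 ht))
            (hξ.indep n hn1) (hξ.law n hn1) hY hφ hB
      _ ≤ ∫⁻ ω in B, U N n ω ∂P := lintegral_mono fun ω => hmoment n _ _
  have hnull : ∀ j : ℕ, ∀ᵐ ω ∂P, ∃ N, ∀ n, N ≤ n → ‖M n ω - M N ω‖ ^ 2 < 1 / ((j : ℝ) + 1) := by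
    intro j
    have hj : (0 : ℝ) < 1 / ((j : ℝ) + 1) := Nat.one_div_pos_of_nat
    set D : Set Ω := {ω | ¬∃ N, ∀ n, N ≤ n → ‖M n ω - M N ω‖ ^ 2 < 1 / ((j : ℝ) + 1)} with hD
    change P D = 0
    have hbound : ∀ N, 1 ≤ N →
        ENNReal.ofReal (1 / ((j : ℝ) + 1)) * P D ≤ ENNReal.ofReal (τ N) := by
      intro N hN
      have h1 := maximal_inequality (hUmeas N) (fun n hn => hUstep N n hN hn)
        (@MeasurableSet.univ _ (ℱ N)) (ENNReal.ofReal (1 / ((j : ℝ) + 1)))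
      have h2 : ∫⁻ ω in Set.univ, U N N ω ∂P = ENNReal.ofReal (τ N) := by simp [U]
      rw [h2] at h1
      refine le_trans ?_ h1
      gcongr
      intro ω hω
      simp only [hD, Set.mem_ofPred_eq, not_exists, not_forall, not_lt] at hω
      obtain ⟨n, hn, hle⟩ := hω N
      exact ⟨trivial, n, hn, ENNReal.ofReal_le_ofReal (by linarith [hτ0 n])⟩
    have hlim : Tendsto (fun N => ENNReal.ofReal (τ N)) atTop (𝓝 0) := by
      simpa using ENNReal.tendsto_ofReal hτlim
    have h0 := ge_of_tendsto hlim ((eventually_ge_atTop 1).mono hbound)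
    exact (mul_eq_zero.1 (nonpos_iff_eq_zero.1 h0)).resolve_left (ENNReal.ofReal_pos.2 hj).ne'
  filter_upwards [ae_all_iff.2 hnull] with ω hω
  refine Metric.cauchySeq_iff'.2 fun ε hε => ?_
  obtain ⟨j, hj⟩ := exists_nat_one_div_lt (pow_pos hε 2)
  obtain ⟨N, hN⟩ := hω j
  refine ⟨N, fun n hn => ?_⟩
  rw [dist_eq_norm]
  exact lt_of_pow_lt_pow_left₀ 2 hε.le ((hN n hn).trans hj)

end Maximal

/-! ### The common form of the two momentum methods -/

/-- The common form of the heavy-ball and Nesterov trajectories: the iterate is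
`xₙ = zₙ - c vₙ`, the auxiliary sequence makes the gradient step `zₙ₊₁ = zₙ - aₙ gₙ`, and the
velocity contracts, `vₙ₊₁ = β vₙ - κ aₙ gₙ`, for `n ≥ 1`. -/
structure IsMomentumScheme {E : Type*} [AddCommGroup E] [Module ℝ E] (a : ℕ → ℝ) (β κ c : ℝ)
    (g x z v : ℕ → E) : Prop where
  x_eq : ∀ n, 1 ≤ n → x n = z n - c • v n
  z_succ : ∀ n, 1 ≤ n → z (n + 1) = z n - a n • g n
  v_succ : ∀ n, 1 ≤ n → v (n + 1) = β • v n - (κ * a n) • g n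

section Schemes

variable {E : Type*} [AddCommGroup E] [Module ℝ E] {α : ℕ → ℝ} {β : ℝ} {g x y : ℕ → E}

theorem IsSHB.isMomentumScheme (h : IsSHB α β g x) (hβ : β < 1) :
    IsMomentumScheme (fun n => α n / (1 - β)) β (1 - β) (β / (1 - β)) g x (auxSHB β x)
      fun n => x n - x (n - 1) := by
  have hβ' : 1 - β ≠ 0 := by linarith
  refine ⟨fun n _ => by simp [auxSHB], fun n hn => ?_, fun n hn => ?_⟩
  · rw [auxSHB, auxSHB, Nat.add_sub_cancel, h n hn]
    match_scalars <;> field_simp <;> ring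
  · rw [Nat.add_sub_cancel, h n hn, mul_div_cancel₀ _ hβ']
    abel

theorem IsSNAG.isMomentumScheme (h : IsSNAG α β g x y) (hβ : β < 1) :
    IsMomentumScheme (fun n => α n / (1 - β)) β (β * (1 - β)) (β / (1 - β)) g x (auxSNAG β x y)
      fun n => x n - y n := by
  have hβ' : 1 - β ≠ 0 := by linarith
  refine ⟨fun n _ => by simp [auxSNAG], fun n hn => ?_, fun n hn => ?_⟩
  · rw [auxSNAG, auxSNAG, (h n hn).2, (h n hn).1]
    match_scalars <;> field_simp <;> ring
  · rw [mul_assoc, mul_div_cancel₀ _ hβ', (h n hn).2, (h n hn).1]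
    match_scalars <;> ring

end Schemes

/-! ### The energy of the momentum methods -/

section Energy

variable {d : ℕ} {f : EuclideanSpace ℝ (Fin d) → ℝ} {L : ℝ}

/-- The Lyapunov function `f(z) - inf f + ‖v‖² + 1`. The added constant turns additive errors
into multiplicative ones. -/
noncomputable def energy (f : EuclideanSpace ℝ (Fin d) → ℝ) (z v : EuclideanSpace ℝ (Fin d)) : ℝ :=
  f z - (⨅ w, f w) + ‖v‖ ^ 2 + 1

theorem energy_nonneg (hf : BddBelow (Set.range f)) (z v : EuclideanSpace ℝ (Fin d)) :
    0 ≤ energy f z v := by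
  have := ciInf_le hf z
  unfold energy
  linarith [sq_nonneg ‖v‖]

/-- The first-order part of the expected change of energy is of second order in the step size:
`p` is the gradient at the iterate `x`, `q` the gradient at `z = x + c v`. The decrease
`-a ‖p‖²` absorbs the terms `a ‖v‖ ‖p‖` up to a multiple of `a ‖v‖²`, which the contraction of
the velocity absorbs up to a multiple of `a² ‖v‖²`. -/
theorem first_order_le {E : Type*} [NormedAddCommGroup E] [InnerProductSpace ℝ E] {β κ a l : ℝ}
    (hβ0 : 0 ≤ β) (hβ1 : β < 1) (hκ : 0 ≤ κ) (ha : 0 ≤ a) {p q v : E} (hpq : ‖q - p‖ ≤ l * ‖v‖) :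
    β ^ 2 * ‖v‖ ^ 2 - a * inner ℝ q p - 2 * β * κ * a * inner ℝ v p ≤
      (1 + (l + 2 * β * κ) ^ 4 / (64 * (1 - β ^ 2)) * a ^ 2) * ‖v‖ ^ 2 := by
  have hδ : 0 < 1 - β ^ 2 := by nlinarith
  set m := l + 2 * β * κ
  have h1 : -inner ℝ q p ≤ -‖p‖ ^ 2 + l * ‖v‖ * ‖p‖ := by
    have h2 : inner ℝ q p = inner ℝ (q - p) p + ‖p‖ ^ 2 := by
      rw [inner_sub_left, real_inner_self_eq_norm_sq]
      ring
    have h3 := (abs_le.1 (abs_real_inner_le_norm (q - p) p)).1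
    nlinarith [mul_le_mul_of_nonneg_right hpq (norm_nonneg p)]
  have h4 : -inner ℝ v p ≤ ‖v‖ * ‖p‖ := by
    linarith [(abs_le.1 (abs_real_inner_le_norm v p)).1]
  have h5 : -‖p‖ ^ 2 + m * ‖v‖ * ‖p‖ ≤ m ^ 2 / 4 * ‖v‖ ^ 2 := by
    nlinarith [sq_nonneg (‖p‖ - m / 2 * ‖v‖)]
  have h6 : a * (m ^ 2 / 4) ≤ (1 - β ^ 2) + m ^ 4 / (64 * (1 - β ^ 2)) * a ^ 2 := by
    have h7 : (1 - β ^ 2) + m ^ 4 / (64 * (1 - β ^ 2)) * a ^ 2 - a * (m ^ 2 / 4) =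
        ((1 - β ^ 2) - a * m ^ 2 / 8) ^ 2 / (1 - β ^ 2) := by
      field_simp
      ring
    have : 0 ≤ ((1 - β ^ 2) - a * m ^ 2 / 8) ^ 2 / (1 - β ^ 2) := by positivity
    linarith
  have h8 : -(a * inner ℝ q p) - 2 * β * κ * a * inner ℝ v p ≤ a * (m ^ 2 / 4 * ‖v‖ ^ 2) := by
    have h9 := mul_le_mul_of_nonneg_left h1 ha
    have h10 := mul_le_mul_of_nonneg_left h4 (by positivity : 0 ≤ 2 * β * κ * a)
    have h11 := mul_le_mul_of_nonneg_left h5 ha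
    simp only [m] at h11 ⊢
    linarith
  nlinarith [mul_le_mul_of_nonneg_right h6 (sq_nonneg ‖v‖)]

variable {Ξ : Type*} [MeasurableSpace Ξ] {ν : Measure Ξ}
  {G : EuclideanSpace ℝ (Fin d) → Ξ → EuclideanSpace ℝ (Fin d)}

/-- Second moments of the oracle at `x = z - c v` are bounded by the energy at `(z, v)`. -/
theorem exists_second_moment_le_energy (h : IsLSmooth f L) (hABC : ABCCondition f G ν) (c : ℝ) :
    ∃ K, 0 ≤ K ∧ ∀ z v, ∫ s, ‖G (z - c • v) s‖ ^ 2 ∂ν ≤ K * energy f z v := by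
  obtain ⟨A, B, C, hA, hB, hC, hbound⟩ := hABC.bound
  have hL := h.pos
  refine ⟨(A + 4 * L * B) * (2 + 2 * L * c ^ 2) + C, by positivity, fun z v => ?_⟩
  set x := z - c • v
  have hFz : 0 ≤ f z - ⨅ w, f w := sub_nonneg.2 (ciInf_le hABC.bddBelow z)
  have hp := h.sq_norm_gradient_le hABC.bddBelow x
  have hq := h.sq_norm_gradient_le hABC.bddBelow z
  have hx : f x - ⨅ w, f w ≤ 2 * (f z - ⨅ w, f w) + 2 * L * c ^ 2 * ‖v‖ ^ 2 := by
    have h1 := h.le_quadratic z (-(c • v))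
    have h2 := real_inner_le_norm (gradient f z) (-(c • v))
    have h3 : ‖-(c • v)‖ ^ 2 = c ^ 2 * ‖v‖ ^ 2 := by
      rw [norm_neg, norm_smul, mul_pow, Real.norm_eq_abs, sq_abs]
    rw [← sub_eq_add_neg] at h1
    have h4 : ‖gradient f z‖ * ‖-(c • v)‖ ≤ (f z - ⨅ w, f w) + L * ‖-(c • v)‖ ^ 2 := by
      have h5 : 0 ≤ (‖gradient f z‖ - 2 * L * ‖-(c • v)‖) ^ 2 := sq_nonneg _
      have h6 : 4 * L * (‖gradient f z‖ * ‖-(c • v)‖) ≤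
          4 * L * ((f z - ⨅ w, f w) + L * ‖-(c • v)‖ ^ 2) := by nlinarith
      exact le_of_mul_le_mul_left h6 (by positivity)
    rw [h3] at h1 h4
    linarith
  have h7 : ∫ s, ‖G x s‖ ^ 2 ∂ν ≤ (A + 4 * L * B) * (f x - ⨅ w, f w) + C := by
    nlinarith [hbound x, mul_le_mul_of_nonneg_left hp hB]
  have h8 := mul_le_mul_of_nonneg_left hx (by positivity : 0 ≤ A + 4 * L * B)
  have hv := sq_nonneg ‖v‖
  have hLc : 0 ≤ 2 * L * c ^ 2 := by positivity
  have h9 : 2 * (f z - ⨅ w, f w) + 2 * L * c ^ 2 * ‖v‖ ^ 2 ≤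
      (2 + 2 * L * c ^ 2) * energy f z v := by
    unfold energy
    nlinarith [mul_nonneg hLc hFz]
  have h10 := mul_le_mul_of_nonneg_left h9 (by positivity : 0 ≤ A + 4 * L * B)
  have h11 : C ≤ C * energy f z v := le_mul_of_one_le_right hC (by unfold energy; linarith)
  linarith

/-- The energy is, in expectation, multiplied by at most `1 + K a²` in a step of size `a`. -/
theorem exists_lintegral_energy_le [IsProbabilityMeasure ν] (h : IsLSmooth f L)
    (hG : IsUnbiasedOracle f G ν) (hABC : ABCCondition f G ν) {β κ c : ℝ} (hβ0 : 0 ≤ β)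
    (hβ1 : β < 1) (hκ : 0 ≤ κ) (hc : 0 ≤ c) :
    ∃ K, 0 ≤ K ∧ ∀ a, 0 ≤ a → ∀ z v,
      ∫⁻ s, ENNReal.ofReal (energy f (z - a • G (z - c • v) s)
        (β • v - (κ * a) • G (z - c • v) s)) ∂ν ≤
      ENNReal.ofReal ((1 + K * a ^ 2) * energy f z v) := by
  obtain ⟨K₂, hK₂, hsecond⟩ := exists_second_moment_le_energy h hABC c
  have hL := h.pos
  have hδ : 0 < 1 - β ^ 2 := by nlinarith
  refine ⟨(L * c + 2 * β * κ) ^ 4 / (64 * (1 - β ^ 2)) + (L + κ ^ 2) * K₂, by positivity,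
    fun a ha z v => ?_⟩
  set x := z - c • v with hx
  set w := a • gradient f z + (2 * β * κ * a) • v with hw
  have hGint := hG.integrable x
  have hG2 := hABC.integrable_sq x
  -- the quadratic upper bound of the energy after the step
  have hpt : ∀ s, energy f (z - a • G x s) (β • v - (κ * a) • G x s) ≤
      (f z - (⨅ w, f w) + β ^ 2 * ‖v‖ ^ 2 + 1) +
        (-inner ℝ w (G x s) + (L + κ ^ 2) * a ^ 2 * ‖G x s‖ ^ 2) := by
    intro s
    have h1 := h.le_quadratic z (-(a • G x s))
    rw [← sub_eq_add_neg, inner_neg_right, inner_smul_right, norm_neg, norm_smul, mul_pow,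
      Real.norm_eq_abs, sq_abs] at h1
    have h2 : ‖β • v - (κ * a) • G x s‖ ^ 2 = β ^ 2 * ‖v‖ ^ 2 -
        2 * β * κ * a * inner ℝ v (G x s) + κ ^ 2 * a ^ 2 * ‖G x s‖ ^ 2 := by
      rw [norm_sub_sq_real, inner_smul_left, inner_smul_right, norm_smul, norm_smul, mul_pow,
        mul_pow, Real.norm_eq_abs, Real.norm_eq_abs, sq_abs, sq_abs, conj_trivial]
      ring
    rw [energy, h2, hw, inner_add_left, inner_smul_left, inner_smul_left, conj_trivial,
      conj_trivial]
    linarith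
  have hi1 : Integrable (fun s => -inner ℝ w (G x s)) ν := (hGint.const_inner w).neg
  have hi2 : Integrable (fun s => (L + κ ^ 2) * a ^ 2 * ‖G x s‖ ^ 2) ν := hG2.const_mul _
  have hi3 : Integrable (fun s => -inner ℝ w (G x s) + (L + κ ^ 2) * a ^ 2 * ‖G x s‖ ^ 2) ν :=
    hi1.add hi2
  have hi := (integrable_const (μ := ν) (f z - (⨅ w, f w) + β ^ 2 * ‖v‖ ^ 2 + 1)).add hi3
  calc ∫⁻ s, ENNReal.ofReal (energy f (z - a • G x s) (β • v - (κ * a) • G x s)) ∂ν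
      ≤ ∫⁻ s, ENNReal.ofReal ((f z - (⨅ w, f w) + β ^ 2 * ‖v‖ ^ 2 + 1) +
        (-inner ℝ w (G x s) + (L + κ ^ 2) * a ^ 2 * ‖G x s‖ ^ 2)) ∂ν :=
        lintegral_mono fun s => ENNReal.ofReal_le_ofReal (hpt s)
    _ = ENNReal.ofReal (∫ s, ((f z - (⨅ w, f w) + β ^ 2 * ‖v‖ ^ 2 + 1) +
        (-inner ℝ w (G x s) + (L + κ ^ 2) * a ^ 2 * ‖G x s‖ ^ 2)) ∂ν) :=
        (ofReal_integral_eq_lintegral_ofReal hi (Eventually.of_forall fun s =>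
          (energy_nonneg hABC.bddBelow _ _).trans (hpt s))).symm
    _ ≤ _ := ENNReal.ofReal_le_ofReal ?_
  rw [integral_add (integrable_const _) hi3, integral_add hi1 hi2, integral_neg,
    integral_inner hGint, hG.unbiased, integral_const_mul, integral_const, probReal_univ, one_smul]
  have hpq : ‖gradient f z - gradient f x‖ ≤ L * c * ‖v‖ := by
    refine (h.lipschitz z x).trans_eq ?_
    rw [hx, sub_sub_cancel, norm_smul, Real.norm_of_nonneg hc, mul_assoc]
  have h1 := first_order_le hβ0 hβ1 hκ ha hpq
  have h2 := mul_le_mul_of_nonneg_left (hsecond z v)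
    (by positivity : 0 ≤ (L + κ ^ 2) * a ^ 2)
  have h3 : inner ℝ w (gradient f x) = a * inner ℝ (gradient f z) (gradient f x) +
      2 * β * κ * a * inner ℝ v (gradient f x) := by
    rw [hw, inner_add_left, inner_smul_left, inner_smul_left, conj_trivial, conj_trivial]
  have hFz : 0 ≤ f z - ⨅ w, f w := sub_nonneg.2 (ciInf_le hABC.bddBelow z)
  have h4 : 0 ≤ (L * c + 2 * β * κ) ^ 4 / (64 * (1 - β ^ 2)) * a ^ 2 * (f z - (⨅ w, f w) + 1) := by
    have : 0 ≤ L * c + 2 * β * κ := by positivity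
    positivity
  rw [h3]
  simp only [energy] at h2 ⊢
  linarith

end Energy

/-! ### Almost sure behaviour of momentum schemes -/

section Scheme

/-- A linear recursion with contraction factor `β < 1` and vanishing input tends to zero. -/
theorem tendsto_zero_of_contracting_recursion {E : Type*} [NormedAddCommGroup E] [NormedSpace ℝ E]
    {β : ℝ} (hβ0 : 0 ≤ β) (hβ1 : β < 1) {v r : ℕ → E}
    (h : ∀ n, 1 ≤ n → v (n + 1) = β • v n + r n) (hr : Tendsto r atTop (𝓝 0)) :
    Tendsto v atTop (𝓝 0) := by
  refine squeeze_zero_norm' (a := fun n => ‖v n‖) (Eventually.of_forall fun _ => le_rfl) ?_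
  refine Metric.tendsto_atTop.2 fun ε hε => ?_
  have hβ : 0 < 1 - β := by linarith
  obtain ⟨N, hN⟩ := eventually_atTop.1
    (((tendsto_zero_iff_norm_tendsto_zero.1 hr).eventually_le_const
      (by positivity : 0 < (1 - β) * (ε / 2))).and (eventually_ge_atTop 1))
  have hk : ∀ k, ‖v (N + k)‖ ≤ β ^ k * ‖v N‖ + ε / 2 := by
    intro k
    induction k with
    | zero => simpa using (half_pos hε).le
    | succ k ih =>
      have h1 := hN (N + k) (Nat.le_add_right N k)
      calc ‖v (N + (k + 1))‖ = ‖β • v (N + k) + r (N + k)‖ := by rw [← add_assoc, h _ h1.2]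
        _ ≤ β * ‖v (N + k)‖ + (1 - β) * (ε / 2) := by
          refine (norm_add_le _ _).trans (add_le_add ?_ h1.1)
          rw [norm_smul, Real.norm_of_nonneg hβ0]
        _ ≤ β * (β ^ k * ‖v N‖ + ε / 2) + (1 - β) * (ε / 2) := by gcongr
        _ = β ^ (k + 1) * ‖v N‖ + ε / 2 := by ring
  have hlim : Tendsto (fun k => β ^ k * ‖v N‖) atTop (𝓝 0) := by
    simpa using (tendsto_pow_atTop_nhds_zero_of_lt_one hβ0 hβ1).mul_const ‖v N‖
  obtain ⟨k₀, hk₀⟩ := eventually_atTop.1 (hlim.eventually_lt_const (half_pos hε))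
  refine ⟨N + k₀, fun n hn => ?_⟩
  obtain ⟨k, rfl⟩ := Nat.exists_eq_add_of_le ((Nat.le_add_right N k₀).trans hn)
  rw [Real.dist_eq, sub_zero, abs_of_nonneg (norm_nonneg _)]
  linarith [hk k, hk₀ k (by omega)]

variable {d : ℕ} {f : EuclideanSpace ℝ (Fin d) → ℝ} {L : ℝ}
  {Ξ : Type*} [MeasurableSpace Ξ] {ν : Measure Ξ}
  {G : EuclideanSpace ℝ (Fin d) → Ξ → EuclideanSpace ℝ (Fin d)}
  {Ω : Type*} {mΩ : MeasurableSpace Ω} {P : Measure Ω}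
  {ℱ : Filtration ℕ mΩ} {ξ : ℕ → Ω → Ξ} {a : ℕ → ℝ} {β κ c : ℝ}
  {x z v : ℕ → Ω → EuclideanSpace ℝ (Fin d)}

theorem measurable_scheme (hG : IsUnbiasedOracle f G ν) (hξ : IsSampling P ℱ ν ξ)
    (hscheme : ∀ ω, IsMomentumScheme a β κ c (fun n => G (x n ω) (ξ n ω)) (fun n => x n ω)
      (fun n => z n ω) fun n => v n ω)
    (hz1 : Measurable[ℱ 1] (z 1)) (hv1 : Measurable[ℱ 1] (v 1)) {n : ℕ} (hn : 1 ≤ n) :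
    Measurable[ℱ n] (z n) ∧ Measurable[ℱ n] (v n) ∧ Measurable[ℱ n] (x n) := by
  have hx : ∀ n, 1 ≤ n → Measurable[ℱ n] (z n) → Measurable[ℱ n] (v n) →
      Measurable[ℱ n] (x n) := fun n hn hz hv => by
    have hxn : x n = fun ω => z n ω - c • v n ω := funext fun ω => (hscheme ω).x_eq n hn
    rw [hxn]
    exact hz.sub (hv.const_smul c)
  induction n, hn using Nat.le_induction with
  | base => exact ⟨hz1, hv1, hx 1 le_rfl hz1 hv1⟩
  | succ n hn ih =>
    obtain ⟨hz, hv, hxn⟩ := ih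
    have hle := ℱ.mono (Nat.le_succ n)
    have hg : Measurable[ℱ (n + 1)] fun ω => G (x n ω) (ξ n ω) := by
      have hxn' : Measurable[ℱ (n + 1)] (x n) := hxn.mono hle le_rfl
      exact hG.measurable.comp (hxn'.prodMk (hξ.adapted n hn))
    have hz' : Measurable[ℱ (n + 1)] (z (n + 1)) := by
      have h1 : z (n + 1) = fun ω => z n ω - a n • G (x n ω) (ξ n ω) :=
        funext fun ω => (hscheme ω).z_succ n hn
      have h2 : Measurable[ℱ (n + 1)] (z n) := hz.mono hle le_rfl
      rw [h1]
      exact h2.sub (hg.const_smul (a n))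
    have hv' : Measurable[ℱ (n + 1)] (v (n + 1)) := by
      have h1 : v (n + 1) = fun ω => β • v n ω - (κ * a n) • G (x n ω) (ξ n ω) :=
        funext fun ω => (hscheme ω).v_succ n hn
      have h2 : Measurable[ℱ (n + 1)] (v n) := hv.mono hle le_rfl
      rw [h1]
      exact (h2.const_smul β).sub (hg.const_smul (κ * a n))
    exact ⟨hz', hv', hx (n + 1) (by omega) hz' hv'⟩

/-- Almost surely, the energy is bounded along the trajectory. -/
theorem ae_bounded_energy [IsProbabilityMeasure ν]
    [IsProbabilityMeasure P] (hf : IsLSmooth f L) (hG : IsUnbiasedOracle f G ν)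
    (hABC : ABCCondition f G ν) (hξ : IsSampling P ℱ ν ξ) (ha : ∀ n, 1 ≤ n → 0 ≤ a n)
    (hsq : Summable fun n => a n ^ 2) (hβ0 : 0 ≤ β) (hβ1 : β < 1) (hκ : 0 ≤ κ) (hc : 0 ≤ c)
    (hscheme : ∀ ω, IsMomentumScheme a β κ c (fun n => G (x n ω) (ξ n ω)) (fun n => x n ω)
      (fun n => z n ω) fun n => v n ω)
    (hz1 : Measurable[ℱ 1] (z 1)) (hv1 : Measurable[ℱ 1] (v 1)) :
    ∀ᵐ ω ∂P, ∃ M, ∀ n, 1 ≤ n → energy f (z n ω) (v n ω) ≤ M := by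
  obtain ⟨K, hK0, hK⟩ := exists_lintegral_energy_le hf hG hABC hβ0 hβ1 hκ hc
  have hmeas := fun n (hn : 1 ≤ n) => measurable_scheme hG hξ hscheme hz1 hv1 hn
  have hfc : Continuous f := hf.contDiff.continuous
  have hVmeas : Measurable fun p : EuclideanSpace ℝ (Fin d) × EuclideanSpace ℝ (Fin d) =>
      ENNReal.ofReal (energy f p.1 p.2) := by
    unfold energy
    have : Measurable f := hfc.measurable
    fun_prop
  have hae := ae_bounded_of_almost_supermartingale (P := P) (ℱ := ℱ) (N := 1)
    (V := fun n ω => ENNReal.ofReal (energy f (z n ω) (v n ω))) (c := fun n => K * a n ^ 2)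
    (fun n hn => hVmeas.comp ((hmeas n hn).1.prodMk (hmeas n hn).2.1))
    (fun _ => ENNReal.ofReal_ne_top) (fun n => mul_nonneg hK0 (sq_nonneg _)) (hsq.mul_left K) ?_
  · filter_upwards [hae] with ω hω
    obtain ⟨M, hM⟩ := hω
    refine ⟨max M 0, fun n hn => ?_⟩
    have h1 := (hM n hn).trans (ENNReal.ofReal_le_ofReal (le_max_left M 0))
    exact (ENNReal.ofReal_le_ofReal_iff (le_max_right M 0)).1 h1
  · intro n hn B hB
    have hφ : Measurable (Function.uncurry
        fun (p : EuclideanSpace ℝ (Fin d) × EuclideanSpace ℝ (Fin d)) (s : Ξ) =>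
          ENNReal.ofReal (energy f (p.1 - a n • G (p.1 - c • p.2) s)
            (β • p.2 - (κ * a n) • G (p.1 - c • p.2) s))) := by
      have hg : Measurable fun q : (EuclideanSpace ℝ (Fin d) × EuclideanSpace ℝ (Fin d)) × Ξ =>
          G (q.1.1 - c • q.1.2) q.2 :=
        hG.measurable.comp ((measurable_fst.fst.sub (measurable_fst.snd.const_smul c)).prodMk
          measurable_snd)
      exact hVmeas.comp ((measurable_fst.fst.sub (hg.const_smul (a n))).prodMk
        ((measurable_fst.snd.const_smul β).sub (hg.const_smul (κ * a n))))
    calc ∫⁻ ω in B, ENNReal.ofReal (energy f (z (n + 1) ω) (v (n + 1) ω)) ∂P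
        = ∫⁻ ω in B, ENNReal.ofReal (energy f (z n ω - a n • G (z n ω - c • v n ω) (ξ n ω))
            (β • v n ω - (κ * a n) • G (z n ω - c • v n ω) (ξ n ω))) ∂P := by
          refine lintegral_congr fun ω => ?_
          rw [(hscheme ω).z_succ n hn, (hscheme ω).v_succ n hn, (hscheme ω).x_eq n hn]
      _ = ∫⁻ ω in B, ∫⁻ s, ENNReal.ofReal (energy f (z n ω - a n • G (z n ω - c • v n ω) s)
            (β • v n ω - (κ * a n) • G (z n ω - c • v n ω) s)) ∂ν ∂P :=
          setLIntegral_freeze (ℱ.le n) (fun _ ht => ℱ.le (n + 1) _ (hξ.adapted n hn ht))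
            (hξ.indep n hn) (hξ.law n hn) ((hmeas n hn).1.prodMk (hmeas n hn).2.1) hφ hB
      _ ≤ ∫⁻ ω in B, ENNReal.ofReal (1 + K * a n ^ 2) *
            ENNReal.ofReal (energy f (z n ω) (v n ω)) ∂P := by
          refine lintegral_mono fun ω => (hK (a n) (ha n hn) _ _).trans_eq ?_
          exact ENNReal.ofReal_mul (by positivity)
      _ = _ := lintegral_const_mul' _ _ ENNReal.ofReal_ne_top

/-- Almost surely, if the iterates are bounded then the partial sums of the weighted gradient noise
form a Cauchy sequence. The noise is truncated where the iterate leaves a ball, which makes its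
second moments uniformly bounded. -/
theorem ae_cauchySeq_noise [IsProbabilityMeasure ν]
    [IsProbabilityMeasure P] (hf : IsLSmooth f L) (hG : IsUnbiasedOracle f G ν)
    (hABC : ABCCondition f G ν) (hξ : IsSampling P ℱ ν ξ)
    (hsq : Summable fun n => a n ^ 2) (hx : ∀ n, 1 ≤ n → Measurable[ℱ n] (x n)) :
    ∀ᵐ ω ∂P, ∀ R : ℝ, (∀ n, 1 ≤ n → ‖x n ω‖ ≤ R) →
      CauchySeq fun n => ∑ i ∈ Finset.Ico 1 n,
        a i • (gradient f (x i ω) - G (x i ω) (ξ i ω)) := by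
  have hK : ∀ K : ℕ, ∀ᵐ ω ∂P, (∀ n, 1 ≤ n → ‖x n ω‖ ≤ K) →
      CauchySeq fun n => ∑ i ∈ Finset.Ico 1 n,
        a i • (gradient f (x i ω) - G (x i ω) (ξ i ω)) := by
    intro K
    obtain ⟨A, B, C, hA, hB, hC, hbound⟩ := hABC.bound
    have hgc := hf.continuous_gradient
    have hfc : Continuous f := hf.contDiff.continuous
    obtain ⟨D, hD⟩ := (isCompact_closedBall (0 : EuclideanSpace ℝ (Fin d))
      K).exists_bound_of_continuousOn (f := fun y => 2 * ‖gradient f y‖ ^ 2 +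
        2 * (A * (f y - ⨅ w, f w) + B * ‖gradient f y‖ ^ 2 + C)) (by fun_prop)
    have hD0 : 0 ≤ D := (norm_nonneg _).trans (hD 0 (by simp))
    let ψ : ℕ → EuclideanSpace ℝ (Fin d) → Ξ → EuclideanSpace ℝ (Fin d) := fun n y s =>
      if ‖y‖ ≤ K then a n • (gradient f y - G y s) else 0
    have hψ : ∀ n, Measurable (Function.uncurry (ψ n)) := fun n =>
      Measurable.ite (measurableSet_le measurable_fst.norm measurable_const)
        (((hgc.measurable.comp measurable_fst).sub hG.measurable).const_smul (a n))
        measurable_const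
    have hdiff : ∀ y, Integrable (fun s => gradient f y - G y s) ν := fun y =>
      (integrable_const _).sub (hG.integrable y)
    have hle : ∀ y s, ‖gradient f y - G y s‖ ^ 2 ≤ 2 * ‖gradient f y‖ ^ 2 + 2 * ‖G y s‖ ^ 2 :=
      fun y s => by
        have h1 := norm_sub_le (gradient f y) (G y s)
        nlinarith [norm_nonneg (gradient f y - G y s),
          sq_nonneg (‖gradient f y‖ - ‖G y s‖)]
    have hbd : ∀ y, Integrable (fun s => 2 * ‖gradient f y‖ ^ 2 + 2 * ‖G y s‖ ^ 2) ν := fun y =>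
      (integrable_const _).add ((hABC.integrable_sq y).const_mul 2)
    have hdiff2 : ∀ y, Integrable (fun s => ‖gradient f y - G y s‖ ^ 2) ν := fun y =>
      (hbd y).mono' ((hdiff y).aestronglyMeasurable.norm.pow 2)
        (Eventually.of_forall fun s => by
          rw [Real.norm_of_nonneg (sq_nonneg _)]
          exact hle y s)
    have hnorm : ∀ n y s, ‖a n • (gradient f y - G y s)‖ ^ 2 =
        a n ^ 2 * ‖gradient f y - G y s‖ ^ 2 := fun n y s => by
      rw [norm_smul, mul_pow, Real.norm_eq_abs, sq_abs]
    have hae := ae_cauchySeq_sum_of_centred hξ hx hψ (c := fun n => a n ^ 2 * D) ?_ ?_ ?_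
      (fun n => mul_nonneg (sq_nonneg _) hD0) (hsq.mul_right D) ?_
    · filter_upwards [hae] with ω hω hb
      have heq : ∀ n, ∑ i ∈ Finset.Ico 1 n, a i • (gradient f (x i ω) - G (x i ω) (ξ i ω)) =
          ∑ i ∈ Finset.Ico 1 n, ψ i (x i ω) (ξ i ω) := fun n =>
        Finset.sum_congr rfl fun i hi => (if_pos (hb i (Finset.mem_Ico.1 hi).1)).symm
      simpa only [heq] using hω
    · intro n y
      by_cases hy : ‖y‖ ≤ K
      · simp only [ψ, if_pos hy]
        exact (hdiff y).smul (a n)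
      · simp only [ψ, if_neg hy]
        exact integrable_const _
    · intro n y
      by_cases hy : ‖y‖ ≤ K
      · simpa only [ψ, if_pos hy, hnorm] using (hdiff2 y).const_mul (a n ^ 2)
      · simp only [ψ, if_neg hy]
        exact integrable_const _
    · intro n y
      by_cases hy : ‖y‖ ≤ K
      · simp only [ψ, if_pos hy]
        rw [integral_smul, integral_sub (integrable_const _) (hG.integrable y), hG.unbiased,
          integral_const, probReal_univ, one_smul, sub_self, smul_zero]
      · simp [ψ, if_neg hy]
    · intro n y
      by_cases hy : ‖y‖ ≤ K
      · simp only [ψ, if_pos hy, hnorm]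
        rw [integral_const_mul]
        refine mul_le_mul_of_nonneg_left ?_ (sq_nonneg _)
        calc ∫ s, ‖gradient f y - G y s‖ ^ 2 ∂ν
            ≤ ∫ s, (2 * ‖gradient f y‖ ^ 2 + 2 * ‖G y s‖ ^ 2) ∂ν :=
              integral_mono (hdiff2 y) (hbd y) (hle y)
          _ = 2 * ‖gradient f y‖ ^ 2 + 2 * ∫ s, ‖G y s‖ ^ 2 ∂ν := by
              rw [integral_add (integrable_const _) ((hABC.integrable_sq y).const_mul 2),
                integral_const, probReal_univ, one_smul, integral_const_mul]
          _ ≤ D := by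
              have h1 := (le_abs_self _).trans (hD y (by simpa using hy))
              linarith [hbound y]
      · simp only [ψ, if_neg hy]
        simpa using mul_nonneg (sq_nonneg (a n)) hD0
  filter_upwards [ae_all_iff.2 hK] with ω hω R hR
  obtain ⟨K, hRK⟩ := exists_nat_ge R
  exact hω K fun n hn => (hR n hn).trans hRK

/-- The conclusions about the auxiliary sequence and the iterates, for the common form of the
two methods. -/
theorem ae_isBoundedPerturbedRM_and_isChainRecurrentContinuum [IsProbabilityMeasure ν]
    [IsProbabilityMeasure P] (hf : IsLSmooth f L)
    (hflat : AsymptoticallyNonFlat f) (hG : IsUnbiasedOracle f G ν) (hABC : ABCCondition f G ν)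
    (hξ : IsSampling P ℱ ν ξ) {α : ℕ → ℝ} (hα : StepSizes α) (hβ0 : 0 ≤ β) (hβ1 : β < 1)
    (hκ : 0 ≤ κ) {Φ : Flow ℝ (EuclideanSpace ℝ (Fin d))} (hΦ : IsGradientFlow f Φ)
    (hscheme : ∀ ω, IsMomentumScheme (fun n => α n / (1 - β)) β κ (β / (1 - β))
      (fun n => G (x n ω) (ξ n ω)) (fun n => x n ω) (fun n => z n ω) fun n => v n ω)
    (hz1 : Measurable[ℱ 1] (z 1)) (hv1 : Measurable[ℱ 1] (v 1)) :
    ∀ᵐ ω ∂P,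
      IsBoundedPerturbedRM f (fun n => α n / (1 - β)) (fun n => z n ω) ∧
      limitSet (fun n => z n ω) = limitSet (fun n => x n ω) ∧
      IsChainRecurrentContinuum Φ (limitSet fun n => z n ω) := by
  have hβ : 0 < 1 - β := by linarith
  set a : ℕ → ℝ := fun n => α n / (1 - β) with haα
  set c : ℝ := β / (1 - β) with hcβ
  have hc : 0 ≤ c := by positivity
  have hapos : ∀ n, 1 ≤ n → 0 < a n := fun n hn => div_pos (hα.pos n hn) hβ
  have hsq : Summable fun n => a n ^ 2 := by
    simpa only [haα, div_pow] using hα.sum_sq.div_const ((1 - β) ^ 2)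
  have ha0 : Tendsto a atTop (𝓝 0) := by
    have h1 := hsq.tendsto_atTop_zero.sqrt
    simp only [Real.sqrt_sq_eq_abs, Real.sqrt_zero] at h1
    exact (tendsto_zero_iff_abs_tendsto_zero a).2 h1
  have htop : Tendsto (fun n => ∑ i ∈ Finset.Icc 1 n, a i) atTop atTop := by
    simpa only [haα, ← Finset.sum_div] using hα.sum_eq_top.atTop_div_const hβ
  have hxm := fun n (hn : 1 ≤ n) => (measurable_scheme hG hξ hscheme hz1 hv1 hn).2.2
  filter_upwards [ae_bounded_energy hf hG hABC hξ (fun n hn => (hapos n hn).le) hsq hβ0 hβ1 hκ hc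
    hscheme hz1 hv1, ae_cauchySeq_noise hf hG hABC hξ hsq hxm] with ω henergy hnoise
  obtain ⟨M, hM⟩ := henergy
  have hs := hscheme ω
  have hFz : ∀ n, 0 ≤ f (z n ω) - ⨅ w, f w := fun n => sub_nonneg.2 (ciInf_le hABC.bddBelow _)
  -- boundedness of `z`, `v` and `x`
  obtain ⟨Rz, hRz⟩ := isBounded_iff_forall_norm_le.1
    (hf.isBounded_sublevel hABC.bddBelow hflat (M + ⨅ w, f w))
  have hzb : ∀ n, 1 ≤ n → ‖z n ω‖ ≤ Rz := fun n hn => hRz _ (by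
    have := hM n hn
    unfold energy at this
    change f (z n ω) ≤ M + ⨅ w, f w
    linarith [sq_nonneg ‖v n ω‖])
  have hvb : ∀ n, 1 ≤ n → ‖v n ω‖ ≤ M + 1 := fun n hn => by
    have := hM n hn
    unfold energy at this
    nlinarith [hFz n, sq_nonneg (‖v n ω‖ - 1)]
  have hxb : ∀ n, 1 ≤ n → ‖x n ω‖ ≤ Rz + c * (M + 1) := fun n hn => by
    rw [hs.x_eq n hn]
    refine (norm_sub_le _ _).trans (add_le_add (hzb n hn) ?_)
    rw [norm_smul, Real.norm_of_nonneg hc]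
    exact mul_le_mul_of_nonneg_left (hvb n hn) hc
  have hcau := hnoise _ hxb
  set u : ℕ → EuclideanSpace ℝ (Fin d) :=
    fun n => gradient f (x n ω) - G (x n ω) (ξ n ω) with hu
  -- the velocity vanishes, as `aₙ gₙ = aₙ ∇f(xₙ) - aₙ uₙ` does
  have hau : Tendsto (fun n => a n • u n) atTop (𝓝 0) := by
    obtain ⟨l, hl⟩ := cauchySeq_tendsto_of_complete hcau
    have h1 := (hl.comp (tendsto_add_atTop_nat 1)).sub hl
    rw [sub_self] at h1
    refine h1.congr' ?_
    filter_upwards [eventually_ge_atTop 1] with n hn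
    simp only [Function.comp, Finset.sum_Ico_succ_top hn, add_sub_cancel_left, hu]
  have hagrad : Tendsto (fun n => a n • gradient f (x n ω)) atTop (𝓝 0) := by
    obtain ⟨D, hD⟩ := (isCompact_closedBall (0 : EuclideanSpace ℝ (Fin d))
      (Rz + c * (M + 1))).exists_bound_of_continuousOn hf.continuous_gradient.continuousOn
    refine ha0.zero_smul_isBoundedUnder_le (isBoundedUnder_of_eventually_le (a := D) ?_)
    filter_upwards [eventually_ge_atTop 1] with n hn
    exact hD _ (by simpa using hxb n hn)
  have hv0 : Tendsto (fun n => v n ω) atTop (𝓝 0) := by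
    refine tendsto_zero_of_contracting_recursion hβ0 hβ1
      (r := fun n => -(κ • (a n • gradient f (x n ω) - a n • u n))) (fun n hn => ?_) ?_
    · rw [hs.v_succ n hn]
      simp only [hu]
      rw [← smul_sub, sub_sub_cancel, smul_smul, sub_eq_add_neg]
    · simpa using ((hagrad.sub hau).const_smul κ).neg
  have hzx : Tendsto (fun n => z n ω - x n ω) atTop (𝓝 0) := by
    have h1 := hv0.const_smul c
    rw [smul_zero] at h1
    refine h1.congr' ?_
    filter_upwards [eventually_ge_atTop 1] with n hn
    rw [hs.x_eq n hn, sub_sub_cancel]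
  have hRM : IsBoundedPerturbedRM f a (fun n => z n ω) := by
    refine ⟨hapos, htop, ha0, ?_, u, fun n => gradient f (z n ω) - gradient f (x n ω),
      fun n hn => ?_, ?_, fun T _ ε hε => ?_⟩
    · refine isBounded_iff_forall_norm_le.2 ⟨max Rz ‖z 0 ω‖, ?_⟩
      rintro _ ⟨n, rfl⟩
      rcases Nat.eq_zero_or_pos n with rfl | hn
      · exact le_max_right _ _
      · exact (hzb n hn).trans (le_max_left _ _)
    · refine (hs.z_succ n hn).trans ?_
      rw [sub_eq_add_neg, ← smul_neg]
      congr 2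
      simp only [hu]
      abel
    · refine squeeze_zero_norm (fun n => hf.lipschitz _ _) ?_
      simpa using hzx.norm.const_mul L
    · obtain ⟨N, hN⟩ := Metric.cauchySeq_iff.1 hcau ε hε
      refine ⟨N, fun n k hn hn1 _ _ => ?_⟩
      rcases le_total n k with hnk | hkn
      · have h1 := hN k (hn.trans hnk) n hn
        rw [dist_eq_norm, ← Finset.sum_Ico_consecutive _ hn1 hnk, add_sub_cancel_left] at h1
        exact h1.le
      · simpa [Finset.Ico_eq_empty_of_le hkn] using hε.le
  refine ⟨hRM, ?_, hRM.isChainRecurrentContinuum hf hΦ⟩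
  ext p
  have key : ∀ {y y' : ℕ → EuclideanSpace ℝ (Fin d)},
      Tendsto (fun n => y n - y' n) atTop (𝓝 0) → p ∈ limitSet y → p ∈ limitSet y' := by
    intro y y' h hp
    obtain ⟨U, hU, hyp⟩ := mapClusterPt_iff_ultrafilter.1 hp
    refine mem_limitSet_of_tendsto (m := id) hU ?_
    simpa using hyp.sub (h.mono_left hU)
  exact ⟨key hzx, key (by simpa using hzx.neg)⟩

end Scheme

end MomentumSGD

/-! ### Convergence of the stochastic heavy-ball and Nesterov methods -/

theorem mainTheorem2 {d : ℕ} (f : EuclideanSpace ℝ (Fin d) → ℝ) (L : ℝ)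
    (hsmooth : MomentumSGD.IsLSmooth f L)
    (hflat : MomentumSGD.AsymptoticallyNonFlat f)
    {Ξ : Type*} [MeasurableSpace Ξ] (ν : Measure Ξ) [IsProbabilityMeasure ν]
    (G : EuclideanSpace ℝ (Fin d) → Ξ → EuclideanSpace ℝ (Fin d))
    (hG : MomentumSGD.IsUnbiasedOracle f G ν)
    (hABC : MomentumSGD.ABCCondition f G ν)
    {Ω : Type*} {mΩ : MeasurableSpace Ω} (P : Measure Ω) [IsProbabilityMeasure P]
    (ℱ : Filtration ℕ mΩ) (ξ : ℕ → Ω → Ξ) (hξ : MomentumSGD.IsSampling P ℱ ν ξ)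
    (α : ℕ → ℝ) (hα : MomentumSGD.StepSizes α) (β : ℝ) (hβ₀ : 0 ≤ β) (hβ₁ : β < 1) :
    -- the gradient flow is well defined
    (∃! Φ : Flow ℝ (EuclideanSpace ℝ (Fin d)), MomentumSGD.IsGradientFlow f Φ) ∧
    ∀ Φ : Flow ℝ (EuclideanSpace ℝ (Fin d)), MomentumSGD.IsGradientFlow f Φ →
      -- SHB
      (∀ x : ℕ → Ω → EuclideanSpace ℝ (Fin d),
        Measurable[ℱ 1] (x 0) → Measurable[ℱ 1] (x 1) →
        (∀ ω, MomentumSGD.IsSHB α β (fun n => G (x n ω) (ξ n ω)) (fun n => x n ω)) →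
        ∀ᵐ ω ∂P,
          MomentumSGD.IsBoundedPerturbedRM f (fun n => α n / (1 - β))
            (MomentumSGD.auxSHB β (fun n => x n ω)) ∧
          MomentumSGD.limitSet (MomentumSGD.auxSHB β (fun n => x n ω)) =
            MomentumSGD.limitSet (fun n => x n ω) ∧
          MomentumSGD.IsChainRecurrentContinuum Φ
            (MomentumSGD.limitSet (MomentumSGD.auxSHB β (fun n => x n ω)))) ∧
      -- SNAG
      (∀ x y : ℕ → Ω → EuclideanSpace ℝ (Fin d),
        Measurable[ℱ 1] (x 1) → Measurable[ℱ 1] (y 1) →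
        (∀ ω, MomentumSGD.IsSNAG α β (fun n => G (x n ω) (ξ n ω))
          (fun n => x n ω) (fun n => y n ω)) →
        ∀ᵐ ω ∂P,
          MomentumSGD.IsBoundedPerturbedRM f (fun n => α n / (1 - β))
            (MomentumSGD.auxSNAG β (fun n => x n ω) (fun n => y n ω)) ∧
          MomentumSGD.limitSet (MomentumSGD.auxSNAG β (fun n => x n ω) (fun n => y n ω)) =
            MomentumSGD.limitSet (fun n => x n ω) ∧
          MomentumSGD.IsChainRecurrentContinuum Φ
            (MomentumSGD.limitSet
              (MomentumSGD.auxSNAG β (fun n => x n ω) (fun n => y n ω)))) := by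
  have hβ : 0 ≤ 1 - β := by linarith
  refine ⟨hsmooth.existsUnique_gradientFlow, fun Φ hΦ => ⟨fun x hx0 hx1 hx => ?_,
    fun x y hx1 hy1 hxy => ?_⟩⟩
  · have hv1 : Measurable[ℱ 1] fun ω => x 1 ω - x 0 ω := hx1.sub hx0
    have hz1 : Measurable[ℱ 1] fun ω => x 1 ω + (β / (1 - β)) • (x 1 ω - x 0 ω) :=
      hx1.add (hv1.const_smul (β / (1 - β)))
    exact MomentumSGD.ae_isBoundedPerturbedRM_and_isChainRecurrentContinuum hsmooth hflat hG hABC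
      hξ hα hβ₀ hβ₁ hβ hΦ (z := fun n ω => MomentumSGD.auxSHB β (fun n => x n ω) n)
      (v := fun n ω => x n ω - x (n - 1) ω) (fun ω => (hx ω).isMomentumScheme hβ₁) hz1 hv1
  · have hv1 : Measurable[ℱ 1] fun ω => x 1 ω - y 1 ω := hx1.sub hy1
    have hz1 : Measurable[ℱ 1] fun ω => x 1 ω + (β / (1 - β)) • (x 1 ω - y 1 ω) :=
      hx1.add (hv1.const_smul (β / (1 - β)))
    exact MomentumSGD.ae_isBoundedPerturbedRM_and_isChainRecurrentContinuum hsmooth hflat hG hABC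
      hξ hα hβ₀ hβ₁ (mul_nonneg hβ₀ hβ) hΦ
      (z := fun n ω => MomentumSGD.auxSNAG β (fun n => x n ω) (fun n => y n ω) n)
      (v := fun n ω => x n ω - y n ω) (fun ω => (hxy ω).isMomentumScheme hβ₁) hz1 hv1
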